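/- Let $p_j = \tfrac14$ for integers $j \ge 0$ and $p_j = \tfrac12$ for integers $j < 0$. The Half-Plane Half-Comb (HPHC) random walk started at the origin is the Markov chain $\mathbf C(N)=(C_1(N),C_2(N))$, $N = 0,1,2,\ldots$, on $\mathbb Z^2$ with $\mathbf C(0)=(0,0)$ and one-step transition probabilities $$\mathbf P(\mathbf C(N+1)=(k\pm 1,j)\mid \mathbf C(N)=(k,j))=\tfrac12-p_j,\qquad \mathbf P(\mathbf C(N+1)=(k,j\pm 1)\mid \mathbf C(N)=(k,j))=p_j ,$$ for $(k,j)\in\mathbb Z^2$; each formula holds for each choice of sign. (So it is the simple random walk on the square lattice with all horizontal edges strictly below the $x$-axis removed.) **Theorem 3.1.** The return probability of the HPHC walk started at $(0,0)$ satisfies $$\mathbf P(\mathbf C(2N)=(0,0))\sim\frac{2}{\pi N}\qquad\text{as } N\to\infty ,$$ that is, the ratio of the two sides tends to $1$. -/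

import Mathlib

open Filter Asymptotics MeasureTheory ProbabilityTheory

/-- One-step transition probability, from the site `u` to the site `v` of `ℤ × ℤ`, of the
anisotropic nearest-neighbour walk with parameters `p`: from `u = (k, j)` the walk moves to
each of `(k + 1, j)`, `(k - 1, j)` with probability `1 / 2 - p j`, and to each of
`(k, j + 1)`, `(k, j - 1)` with probability `p j`. -/
noncomputable def anisotropicStep (p : ℤ → ℝ) (u v : ℤ × ℤ) : ℝ :=
  if v = (u.1 + 1, u.2) ∨ v = (u.1 - 1, u.2) then 1 / 2 - p u.2
  else if v = (u.1, u.2 + 1) ∨ v = (u.1, u.2 - 1) then p u.2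
  else 0

/-- `C 0, C 1, C 2, …` is a random walk on `ℤ × ℤ`, defined on the probability space `(Ω, μ)`,
started at the origin, with the transition probabilities `anisotropicStep p`. -/
structure IsAnisotropicWalk {Ω : Type*} [MeasurableSpace Ω] (μ : Measure Ω) (p : ℤ → ℝ)
    (C : ℕ → Ω → ℤ × ℤ) : Prop where
  measurable : ∀ N, Measurable (C N)
  start : ∀ᵐ ω ∂μ, C 0 ω = (0, 0)
  /-- The Markov property: given `C 0 = x 0, …, C N = x N`, the conditional probability of
  `C (N + 1) = x (N + 1)` is the transition probability from `x N` to `x (N + 1)`. -/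
  markov : ∀ (N : ℕ) (x : ℕ → ℤ × ℤ),
    μ.real {ω | ∀ i ≤ N + 1, C i ω = x i} =
      μ.real {ω | ∀ i ≤ N, C i ω = x i} * anisotropicStep p (x N) (x (N + 1))

/-- The parameters of the Half-Plane Half-Comb walk: `1 / 4` on the closed upper half-plane
(all four neighbours equally likely) and `1 / 2` strictly below the horizontal axis (vertical
steps only). -/
noncomputable def hphcParam (j : ℤ) : ℝ := if 0 ≤ j then 1 / 4 else 1 / 2

/-- `C` is a Half-Plane Half-Comb (HPHC) walk started at the origin. -/
def IsHPHCWalk {Ω : Type*} [MeasurableSpace Ω] (μ : Measure Ω) (C : ℕ → Ω → ℤ × ℤ) : Prop :=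
  IsAnisotropicWalk μ hphcParam C

/-- One step of the HPHC walk, driven by a symbol `a` uniformly distributed on `Fin 4`. -/
def hphcMove (u : ℤ × ℤ) (a : Fin 4) : ℤ × ℤ :=
  if a = 0 then (u.1, u.2 + 1)
  else if a = 1 then (u.1, u.2 - 1)
  else if a = 2 then (if 0 ≤ u.2 then (u.1 + 1, u.2) else (u.1, u.2 + 1))
  else (if 0 ≤ u.2 then (u.1 - 1, u.2) else (u.1, u.2 - 1))

/-- The path of the HPHC walk driven by a sequence of symbols. -/
def hphcPath : ℕ → (ℕ → Fin 4) → ℤ × ℤ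
  | 0, _ => (0, 0)
  | n + 1, w => hphcMove (hphcPath n w) (w n)

theorem hphcPath_congr (n : ℕ) (w w' : ℕ → Fin 4) (h : ∀ i < n, w i = w' i) :
    hphcPath n w = hphcPath n w' := by
  induction n with
  | zero => rfl
  | succ n ih =>
    simp only [hphcPath]
    rw [ih (fun i hi => h i (by omega)), h n (by omega)]

theorem hphcPath_measurable (n : ℕ) : Measurable (hphcPath n) := by
  induction n with
  | zero => exact measurable_const
  | succ n ih =>
    have h : Measurable (fun q : (ℤ × ℤ) × Fin 4 => hphcMove q.1 q.2) := measurable_of_countable _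
    exact h.comp (ih.prodMk (measurable_pi_apply n))

theorem hphcMove_prob (u v : ℤ × ℤ) :
    (uniformOn (Set.univ : Set (Fin 4))).real {a | hphcMove u a = v} =
      anisotropicStep hphcParam u v := by
  classical
  have h1 : (uniformOn (Set.univ : Set (Fin 4))).real {a | hphcMove u a = v} =
      (∑ a : Fin 4, if hphcMove u a = v then (1 : ℝ) else 0) / 4 := by
    rw [measureReal_def, uniformOn_univ, Measure.count_apply_finite _ (Set.toFinite _)]
    simp [Finset.sum_boole]
  rw [h1, Fin.sum_univ_four]
  obtain ⟨a, b⟩ := u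
  obtain ⟨c, d⟩ := v
  simp only [hphcMove, anisotropicStep, hphcParam, Prod.mk.injEq]
  by_cases hb : 0 ≤ b <;> simp [hb] <;> split_ifs <;> first | omega | norm_num

/-- The HPHC walk exists. -/
theorem exists_isHPHCWalk :
    ∃ μ : Measure (ℕ → Fin 4), IsProbabilityMeasure μ ∧ IsHPHCWalk μ hphcPath := by
  have : IsProbabilityMeasure (uniformOn (Set.univ : Set (Fin 4))) :=
    isProbabilityMeasure_uniformOn Set.finite_univ Set.univ_nonempty
  set ν := uniformOn (Set.univ : Set (Fin 4)) with hν
  refine ⟨Measure.infinitePi (fun _ => ν), inferInstance, hphcPath_measurable,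
    ae_of_all _ fun _ => rfl, fun N x => ?_⟩
  set μ : Measure (ℕ → Fin 4) := Measure.infinitePi (fun _ => ν) with hμ
  have hind : iIndepFun (fun (i : ℕ) (w : ℕ → Fin 4) => w i) μ :=
    iIndepFun_infinitePi (P := fun _ : ℕ => ν) (X := fun _ a => a) (fun _ => measurable_id)
  have hI := (hind.indepFun_finset (Finset.range N) {N} (by simp)
    (fun i => measurable_pi_apply i))
  have hI2 := hI.comp (φ := id) (ψ := fun f : (({N} : Finset ℕ) → Fin 4) =>
    f ⟨N, by simp⟩) measurable_id (measurable_of_countable _)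
  have hA : {w : ℕ → Fin 4 | ∀ i ≤ N, hphcPath i w = x i} =
      (id ∘ fun (w : ℕ → Fin 4) (i : Finset.range N) => w i) ⁻¹'
      ((fun (w : ℕ → Fin 4) (i : Finset.range N) => w i) ''
        {w | ∀ i ≤ N, hphcPath i w = x i}) := by
    ext w
    constructor
    · intro h
      exact ⟨w, h, rfl⟩
    · rintro ⟨w', h', e⟩ i hi
      rw [← h' i hi]
      refine hphcPath_congr i w w' fun j hj => ?_
      exact (congrFun e ⟨j, by simp; omega⟩).symm
  have hB : {w : ℕ → Fin 4 | ∀ i ≤ N + 1, hphcPath i w = x i} =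
      {w | ∀ i ≤ N, hphcPath i w = x i} ∩
      ((fun f : (({N} : Finset ℕ) → Fin 4) => f ⟨N, by simp⟩) ∘
        fun (w : ℕ → Fin 4) (i : ({N} : Finset ℕ)) => w i) ⁻¹'
        {a | hphcMove (x N) a = x (N + 1)} := by
    ext w
    simp only [Set.mem_ofPred_eq, Set.mem_inter_iff, Set.mem_preimage, Function.comp]
    constructor
    · intro h
      refine ⟨fun i hi => h i (by omega), ?_⟩
      rw [← h N (by omega), ← h (N + 1) le_rfl]
      rfl
    · rintro ⟨h1, h2⟩ i hi
      rcases Nat.lt_or_ge N i with h | h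
      · obtain rfl : i = N + 1 := by omega
        rw [← h2, ← h1 N le_rfl]
        rfl
      · exact h1 i h
  have hmap : μ.map (fun w : ℕ → Fin 4 => w N) = ν :=
    Measure.infinitePi_map_eval (fun _ : ℕ => ν) N
  rw [hB, hA, measureReal_def, hI2.measure_inter_preimage_eq_mul _ _
    (Set.toFinite _).measurableSet (Set.toFinite _).measurableSet, ENNReal.toReal_mul,
    ← hphcMove_prob, ← hν, measureReal_def, measureReal_def]
  congr 2
  rw [← hmap, Measure.map_apply (measurable_pi_apply N) (Set.toFinite _).measurableSet]
  rfl

/-! The walk is reversible with respect to the weight `1 / p j`. A Fourier transform in the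
horizontal coordinate, at frequency `θ`, turns it into powers of a one-dimensional operator
`twistedStep p c`, `c = cos θ`, and the return probability is the average over `θ` of their diagonal
entry at `0` (`measureReal_eq_integral`).

For HPHC the resolvent equation of this operator has constant coefficients on each half-line. It is
solved by two geometric sequences glued at `0`, so the Green function is the explicit `4 / hphcDenom
z c`. Hence `F w = ∑ P(C (2N) = 0) w ^ N` is an explicit integral over `θ`. Its singularity at `w =
1` comes from small `θ`, where with `δ = √(1 - w)` the denominator is close to `δ + √(2δ² + θ²)`,
and this can be replaced by `δ + θ` at bounded cost. The result is `F w = -(2/π) log (1 - w) + L +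
o(1)`.

To pass to coefficients, note that a logarithmic main term alone would not suffice, even for
monotone coefficients; the convergence of the remainder to a constant is essential. It lets a
Karamata argument compare `p k` with `c / k` over windows `k / n ∈ (α, β)`, not just over full
partial sums (`tendsto_tsum_sub_mul_weight`). The even return probabilities decrease because
`twistedStep` is a self-adjoint contraction of the weighted `ℓ²`, so windows just above and just
below `n` pin down `n * p n` (`tendsto_nat_mul_of_antitone`). -/

/-! ### One-step recursion for the law of the walk, and parity. -/

theorem hasSum_measureReal_inter_preimage_singleton {Ω α : Type*} [MeasurableSpace Ω]
    [Countable α] [MeasurableSpace α] [MeasurableSingletonClass α] (μ : Measure Ω)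
    [IsFiniteMeasure μ] {H : Ω → α} (hH : Measurable H) {A : Set Ω} (hA : MeasurableSet A) :
    HasSum (fun h => μ.real (A ∩ H ⁻¹' {h})) (μ.real A) := by
  have h1 : A = ⋃ h, A ∩ H ⁻¹' {h} := by
    ext ω
    simp
  have h2 := measure_iUnion (μ := μ) (f := fun h => A ∩ H ⁻¹' {h})
    (fun a b hab => by
      refine Set.disjoint_left.2 fun ω h1 h2 => hab ?_
      exact h1.2.symm.trans h2.2)
    (fun h => hA.inter (hH (measurableSet_singleton h)))
  rw [← h1] at h2
  rw [measureReal_def, h2]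
  simp only [measureReal_def]
  rw [ENNReal.tsum_toReal_eq (fun h => measure_ne_top _ _)]
  refine (ENNReal.summable_toReal ?_).hasSum
  rw [← h2]
  exact measure_ne_top _ _

namespace IsAnisotropicWalk

variable {Ω : Type*} [MeasurableSpace Ω] {μ : Measure Ω} [IsProbabilityMeasure μ]
  {p : ℤ → ℝ} {C : ℕ → Ω → ℤ × ℤ}

/-- The Markov property is assumed only for complete histories; summing it over the countably many
values of `(C 0, …, C N)` forgets the past. -/
theorem measureReal_inter (hC : IsAnisotropicWalk μ p C) (N : ℕ) (u v : ℤ × ℤ) :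
    μ.real {ω | C N ω = u ∧ C (N + 1) ω = v} =
      μ.real {ω | C N ω = u} * anisotropicStep p u v := by
  have hH : Measurable (fun ω (i : Fin (N + 1)) => C i ω) :=
    measurable_pi_lambda _ fun i => hC.measurable i
  have hu : MeasurableSet {ω | C N ω = u} := hC.measurable N (measurableSet_singleton u)
  have hv : MeasurableSet {ω | C (N + 1) ω = v} :=
    hC.measurable (N + 1) (measurableSet_singleton v)
  have s1 := hasSum_measureReal_inter_preimage_singleton μ hH (hu.inter hv)
  have s2 := (hasSum_measureReal_inter_preimage_singleton μ hH hu).mul_right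
    (anisotropicStep p u v)
  suffices H : ∀ h, μ.real ({ω | C N ω = u} ∩ {ω | C (N + 1) ω = v} ∩
      (fun ω (i : Fin (N + 1)) => C i ω) ⁻¹' {h}) = μ.real ({ω | C N ω = u} ∩
      (fun ω (i : Fin (N + 1)) => C i ω) ⁻¹' {h}) * anisotropicStep p u v by
    simp only [H] at s1
    exact s1.unique s2
  intro h
  by_cases hl : h (Fin.last N) = u
  -- The history `h` prolonged by `v`; of the default values only the one at index `N + 1` matters.
  · have key := hC.markov N (fun i => if hi : i < N + 1 then h ⟨i, hi⟩ else v)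
    have e1 : {ω | ∀ i ≤ N + 1, C i ω = if hi : i < N + 1 then h ⟨i, hi⟩ else v} =
        ({ω | C N ω = u} ∩ {ω | C (N + 1) ω = v}) ∩
          (fun ω (i : Fin (N + 1)) => C i ω) ⁻¹' {h} := by
      ext ω
      simp only [Set.mem_ofPred_eq, Set.mem_inter_iff, Set.mem_preimage, Set.mem_singleton_iff]
      constructor
      · intro H
        have H1 : (fun i : Fin (N + 1) => C i ω) = h := by
          funext i
          have := H i (by omega)
          simpa [i.2] using this
        refine ⟨⟨?_, by simpa using H (N + 1) le_rfl⟩, H1⟩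
        rw [← hl, ← H1]
        rfl
      · rintro ⟨⟨_, h2⟩, rfl⟩ i hi
        split_ifs with hi'
        · rfl
        · obtain rfl : i = N + 1 := by omega
          exact h2
    have e2 : {ω | ∀ i ≤ N, C i ω = if hi : i < N + 1 then h ⟨i, hi⟩ else v} =
        {ω | C N ω = u} ∩ (fun ω (i : Fin (N + 1)) => C i ω) ⁻¹' {h} := by
      ext ω
      simp only [Set.mem_ofPred_eq, Set.mem_inter_iff, Set.mem_preimage, Set.mem_singleton_iff]
      constructor
      · intro H
        have H1 : (fun i : Fin (N + 1) => C i ω) = h := by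
          funext i
          have := H i (by omega)
          simpa [i.2] using this
        refine ⟨?_, H1⟩
        rw [← hl, ← H1]
        rfl
      · rintro ⟨_, rfl⟩ i hi
        rw [dif_pos (by omega)]
    rw [e1, e2] at key
    rw [key]
    congr 2
    · rw [dif_pos (by omega), ← hl]
      rfl
    · simp
  · have e : ∀ ω, C N ω = u → (fun i : Fin (N + 1) => C i ω) ≠ h := by
      rintro ω h1 rfl
      exact hl h1
    have e1 : ({ω | C N ω = u} ∩ (fun ω (i : Fin (N + 1)) => C i ω) ⁻¹' {h}) = ∅ := by
      ext ω
      simp only [Set.mem_inter_iff, Set.mem_ofPred_eq, Set.mem_preimage, Set.mem_singleton_iff,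
        Set.mem_empty_iff_false, iff_false, not_and]
      exact e ω
    rw [Set.inter_right_comm, e1]
    simp

theorem measureReal_succ (hC : IsAnisotropicWalk μ p C) (N : ℕ) (k j : ℤ) :
    μ.real {ω | C (N + 1) ω = (k, j)} =
      (1 / 2 - p j) * (μ.real {ω | C N ω = (k - 1, j)} + μ.real {ω | C N ω = (k + 1, j)}) +
      p (j - 1) * μ.real {ω | C N ω = (k, j - 1)} +
      p (j + 1) * μ.real {ω | C N ω = (k, j + 1)} := by
  have hv : MeasurableSet {ω | C (N + 1) ω = (k, j)} :=
    hC.measurable (N + 1) (measurableSet_singleton _)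
  have s1 := hasSum_measureReal_inter_preimage_singleton μ (hC.measurable N) hv
  have e : (fun u => μ.real ({ω | C (N + 1) ω = (k, j)} ∩ C N ⁻¹' {u})) =
      fun u => μ.real {ω | C N ω = u} * anisotropicStep p u (k, j) := by
    funext u
    rw [← hC.measureReal_inter N u (k, j)]
    congr 1
    ext ω
    simp [and_comm]
  rw [e] at s1
  have s2 := hasSum_sum_of_ne_finset_zero
    (L := SummationFilter.unconditional _)
    (f := fun u => μ.real {ω | C N ω = u} * anisotropicStep p u (k, j))
    (s := {(k - 1, j), (k + 1, j), (k, j - 1), (k, j + 1)}) (by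
      rintro ⟨a, b⟩ hu
      simp only [Finset.mem_insert, Finset.mem_singleton, Prod.mk.injEq, not_or] at hu
      simp only [anisotropicStep, Prod.mk.injEq]
      rw [if_neg (by omega), if_neg (by omega), mul_zero])
  rw [s1.unique s2, Finset.sum_insert (by simp; omega), Finset.sum_insert (by simp),
    Finset.sum_insert (by simp; omega), Finset.sum_singleton]
  have t1 : anisotropicStep p (k - 1, j) (k, j) = 1 / 2 - p j := by
    simp [anisotropicStep]
  have t2 : anisotropicStep p (k + 1, j) (k, j) = 1 / 2 - p j := by
    simp [anisotropicStep]
  have t3 : anisotropicStep p (k, j - 1) (k, j) = p (j - 1) := by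
    simp only [anisotropicStep, Prod.mk.injEq]
    rw [if_neg (by omega), if_pos (by simp)]
  have t4 : anisotropicStep p (k, j + 1) (k, j) = p (j + 1) := by
    simp only [anisotropicStep, Prod.mk.injEq]
    rw [if_neg (by omega), if_pos (by simp)]
  rw [t1, t2, t3, t4]
  ring

theorem measureReal_zero (hC : IsAnisotropicWalk μ p C) (v : ℤ × ℤ) :
    μ.real {ω | C 0 ω = v} = if v = (0, 0) then 1 else 0 := by
  split_ifs with h
  · have : μ {ω | C 0 ω = v} = 1 := by
      subst h
      exact (prob_compl_eq_zero_iff (hC.measurable 0 (measurableSet_singleton _))).1 hC.start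
    simp [measureReal_def, this]
  · have : μ {ω | C 0 ω = v} = 0 := by
      refine measure_mono_null ?_ hC.start
      intro ω hω h0
      exact h (hω.symm.trans h0)
    simp [measureReal_def, this]

theorem measureReal_eq_zero_of_odd (hC : IsAnisotropicWalk μ p C) (N : ℕ) (k j : ℤ)
    (h : Odd (N + k + j)) : μ.real {ω | C N ω = (k, j)} = 0 := by
  induction N generalizing k j with
  | zero =>
    rw [hC.measureReal_zero, if_neg]
    rintro h0
    simp only [Prod.mk.injEq] at h0
    simp [h0.1, h0.2] at h
  | succ N ih =>
    rw [hC.measureReal_succ, ih, ih, ih, ih]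
    · ring
    all_goals
      push_cast at h
      simp only [Int.odd_iff] at h ⊢
      omega

end IsAnisotropicWalk

/-! ### Fourier transform in the horizontal coordinate. -/

/-- The transition operator of the vertical coordinate of an anisotropic walk, twisted by a
horizontal frequency of cosine `c`. -/
def twistedStep (p : ℤ → ℝ) (c : ℝ) (f : ℤ → ℝ) (j : ℤ) : ℝ :=
  (1 - 2 * p j) * c * f j + p j * (f (j - 1) + f (j + 1))

/-- The iterates of `twistedStep p c` on the indicator function of `0`. -/
def twistedIter (p : ℤ → ℝ) (c : ℝ) (n : ℕ) : ℤ → ℝ :=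
  (twistedStep p c)^[n] (Pi.single 0 1)

theorem twistedIter_zero (p : ℤ → ℝ) (c : ℝ) : twistedIter p c 0 = Pi.single 0 1 := rfl

theorem twistedIter_succ (p : ℤ → ℝ) (c : ℝ) (n : ℕ) :
    twistedIter p c (n + 1) = twistedStep p c (twistedIter p c n) :=
  Function.iterate_succ_apply' _ _ _

theorem continuous_twistedIter (p : ℤ → ℝ) (n : ℕ) (j : ℤ) :
    Continuous fun c => twistedIter p c n j := by
  induction n generalizing j with
  | zero => exact continuous_const
  | succ n ih =>
    simp only [twistedIter_succ, twistedStep]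
    have := ih j
    have := ih (j - 1)
    have := ih (j + 1)
    fun_prop

theorem integral_cos_int_mul (k : ℤ) :
    ∫ θ in (0 : ℝ)..Real.pi, Real.cos (k * θ) = if k = 0 then Real.pi else 0 := by
  split_ifs with h
  · simp [h]
  · have hk : (k : ℝ) ≠ 0 := by exact_mod_cast h
    rw [intervalIntegral.integral_comp_mul_left (fun x => Real.cos x) hk]
    simp [integral_cos, Real.sin_int_mul_pi]

namespace IsAnisotropicWalk

variable {Ω : Type*} [MeasurableSpace Ω] {μ : Measure Ω} [IsProbabilityMeasure μ]
  {p : ℤ → ℝ} {C : ℕ → Ω → ℤ × ℤ}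

/-- The law obeys the forward equation, with coefficients `p (j ± 1)`, while `twistedStep` is the
backward operator, with coefficient `p j`; the reversible weight ratio `p 0 / p j` converts one into
the other. The horizontal steps become multiplication by `cos θ` through `cos ((k - 1) θ) + cos ((k
+ 1) θ) = 2 cos θ cos (k θ)`. -/
theorem measureReal_eq_integral (hC : IsAnisotropicWalk μ p C) (hp : ∀ j, p j ≠ 0)
    (N : ℕ) (k j : ℤ) :
    μ.real {ω | C N ω = (k, j)} = p 0 / p j * (Real.pi⁻¹ *
      ∫ θ in (0 : ℝ)..Real.pi, twistedIter p (Real.cos θ) N j * Real.cos (k * θ)) := by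
  induction N generalizing k j with
  | zero =>
    rw [hC.measureReal_zero]
    by_cases hj : j = 0
    · subst hj
      simp only [twistedIter_zero, Pi.single_eq_same, one_mul, integral_cos_int_mul]
      rw [div_self (hp 0)]
      by_cases hk : k = 0 <;> simp [hk, Real.pi_ne_zero]
    · simp [twistedIter_zero, hj]
  | succ N ih =>
    have hc : ∀ (a b : ℤ), IntervalIntegrable
        (fun θ => twistedIter p (Real.cos θ) N a * Real.cos (b * θ)) volume 0 Real.pi := by
      intro a b
      have := (continuous_twistedIter p N a).comp Real.continuous_cos
      simp only [Function.comp_def] at this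
      exact Continuous.intervalIntegrable (by fun_prop) _ _
    have hI : ∫ θ in (0 : ℝ)..Real.pi,
        twistedIter p (Real.cos θ) (N + 1) j * Real.cos (k * θ) =
        (1 / 2 - p j) * ((∫ θ in (0 : ℝ)..Real.pi,
          twistedIter p (Real.cos θ) N j * Real.cos ((k - 1 : ℤ) * θ)) +
          ∫ θ in (0 : ℝ)..Real.pi,
          twistedIter p (Real.cos θ) N j * Real.cos ((k + 1 : ℤ) * θ)) +
        p j * ((∫ θ in (0 : ℝ)..Real.pi,
          twistedIter p (Real.cos θ) N (j - 1) * Real.cos (k * θ)) +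
          ∫ θ in (0 : ℝ)..Real.pi,
          twistedIter p (Real.cos θ) N (j + 1) * Real.cos (k * θ)) := by
      rw [← intervalIntegral.integral_add (hc _ _) (hc _ _),
        ← intervalIntegral.integral_add (hc _ _) (hc _ _),
        ← intervalIntegral.integral_const_mul, ← intervalIntegral.integral_const_mul,
        ← intervalIntegral.integral_add (((hc _ _).add (hc _ _)).const_mul _)
          (((hc _ _).add (hc _ _)).const_mul _)]
      refine intervalIntegral.integral_congr fun θ _ => ?_
      simp only [twistedIter_succ, twistedStep]
      push_cast
      rw [sub_mul (k : ℝ) 1 θ, add_mul (k : ℝ) 1 θ, one_mul, Real.cos_sub, Real.cos_add]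
      ring
    rw [hC.measureReal_succ, ih, ih, ih, ih, hI]
    have h1 := hp j
    have h2 := hp (j - 1)
    have h3 := hp (j + 1)
    have h4 := Real.pi_ne_zero
    field_simp
    ring

end IsAnisotropicWalk

/-! ### The twisted operator: resolvent, self-adjointness, contraction. -/

theorem tsum_comp_add_int (f : ℤ → ℝ) (a : ℤ) : ∑' j, f (j + a) = ∑' j, f j :=
  (Equiv.addRight a).tsum_eq f

theorem summable_comp_add_int {f : ℤ → ℝ} (h : Summable f) (a : ℤ) :
    Summable fun j => f (j + a) :=
  (Equiv.addRight a).summable_iff.2 h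

/-- Jensen for the weights `1 - 2q, q, q`: the defect is the variance, a sum of weighted squared
differences, plus the loss from `c ^ 2 ≤ 1`. -/
theorem sq_convex_comb_le {q c : ℝ} (hq : 0 ≤ q) (hq' : q ≤ 1 / 2) (hc : |c| ≤ 1) (x y z : ℝ) :
    ((1 - 2 * q) * c * x + q * (y + z)) ^ 2 ≤ (1 - 2 * q) * x ^ 2 + y ^ 2 * q + z ^ 2 * q := by
  have hcc : c ^ 2 ≤ 1 := by
    rw [← sq_abs]
    exact pow_le_one₀ (abs_nonneg c) hc
  have hw : 0 ≤ 1 - 2 * q := by linarith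
  have i1 : 0 ≤ (1 - 2 * q) * ((1 - c ^ 2) * x ^ 2) :=
    mul_nonneg hw (mul_nonneg (by linarith) (sq_nonneg _))
  have i2 := mul_nonneg (mul_nonneg hw hq) (sq_nonneg (c * x - y))
  have i3 := mul_nonneg (mul_nonneg hw hq) (sq_nonneg (c * x - z))
  have i4 := mul_nonneg (mul_nonneg hq hq) (sq_nonneg (y - z))
  linear_combination i1 + i2 + i3 + i4

section twisted

variable {p : ℤ → ℝ} {c : ℝ}

theorem abs_twistedStep_le (hp : ∀ j, 0 ≤ p j) (hp' : ∀ j, p j ≤ 1 / 2) (hc : |c| ≤ 1)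
    {f : ℤ → ℝ} {M : ℝ} (hf : ∀ j, |f j| ≤ M) (j : ℤ) : |twistedStep p c f j| ≤ M := by
  have h1 : |c * f j| ≤ M := by
    rw [abs_mul]
    nlinarith [abs_nonneg (f j), abs_nonneg c, hf j]
  have h0 := hp j
  have h0' := hp' j
  obtain ⟨a1, a2⟩ := abs_le.1 h1
  obtain ⟨b1, b2⟩ := abs_le.1 (hf (j - 1))
  obtain ⟨c1, c2⟩ := abs_le.1 (hf (j + 1))
  have hw : 0 ≤ 1 - 2 * p j := by linarith
  unfold twistedStep
  rw [abs_le, mul_assoc]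
  constructor
  · nlinarith [mul_le_mul_of_nonneg_left a1 hw, mul_le_mul_of_nonneg_left b1 h0,
      mul_le_mul_of_nonneg_left c1 h0]
  · nlinarith [mul_le_mul_of_nonneg_left a2 hw, mul_le_mul_of_nonneg_left b2 h0,
      mul_le_mul_of_nonneg_left c2 h0]

theorem abs_twistedIter_le_one (hp : ∀ j, 0 ≤ p j) (hp' : ∀ j, p j ≤ 1 / 2) (hc : |c| ≤ 1)
    (n : ℕ) (j : ℤ) : |twistedIter p c n j| ≤ 1 := by
  induction n generalizing j with
  | zero =>
    rw [twistedIter_zero, Pi.single_apply]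
    split_ifs <;> simp
  | succ n ih =>
    rw [twistedIter_succ]
    exact abs_twistedStep_le hp hp' hc ih j

theorem abs_twistedStep_iterate_le (hp : ∀ j, 0 ≤ p j) (hp' : ∀ j, p j ≤ 1 / 2) (hc : |c| ≤ 1)
    {f : ℤ → ℝ} {M : ℝ} (hf : ∀ j, |f j| ≤ M) (n : ℕ) (j : ℤ) :
    |(twistedStep p c)^[n] f j| ≤ M := by
  induction n generalizing j with
  | zero => exact hf j
  | succ n ih =>
    rw [Function.iterate_succ_apply']
    exact abs_twistedStep_le hp hp' hc ih j

theorem twistedStep_iterate_add_mul (f g : ℤ → ℝ) (z : ℝ) (n : ℕ) :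
    (twistedStep p c)^[n] (fun j => f j + z * g j) =
      fun j => (twistedStep p c)^[n] f j + z * (twistedStep p c)^[n] g j := by
  induction n with
  | zero => rfl
  | succ n ih =>
    simp only [Function.iterate_succ_apply', ih]
    funext j
    simp only [twistedStep]
    ring

/-- A bounded solution of the resolvent equation is the generating function of the iterates. -/
theorem hasSum_pow_mul_twistedIter (hp : ∀ j, 0 ≤ p j) (hp' : ∀ j, p j ≤ 1 / 2) (hc : |c| ≤ 1)
    {z : ℝ} (hz : 0 ≤ z) (hz1 : z < 1) {g : ℤ → ℝ} {M : ℝ} (hg : ∀ j, |g j| ≤ M)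
    (h : ∀ j, g j = (Pi.single 0 1 : ℤ → ℝ) j + z * twistedStep p c g j) (j : ℤ) :
    HasSum (fun n => z ^ n * twistedIter p c n j) (g j) := by
  have key : ∀ n : ℕ, ∑ k ∈ Finset.range n, z ^ k * twistedIter p c k j =
      g j - z ^ n * (twistedStep p c)^[n] g j := by
    intro n
    induction n with
    | zero => simp
    | succ n ih =>
      have h1 : (twistedStep p c)^[n] g j = twistedIter p c n j +
          z * (twistedStep p c)^[n + 1] g j := by
        -- Unfolds the resolvent equation once more inside the remainder `T ^ n g`.
        conv_lhs => rw [funext h]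
        rw [twistedStep_iterate_add_mul, Function.iterate_succ_apply]
        rfl
      rw [Finset.sum_range_succ, ih, h1]
      ring
  have hs : Summable fun n => z ^ n * twistedIter p c n j := by
    refine Summable.of_norm_bounded (summable_geometric_of_lt_one hz hz1) fun n => ?_
    rw [norm_mul, norm_pow, Real.norm_of_nonneg hz]
    exact mul_le_of_le_one_right (by positivity) (abs_twistedIter_le_one hp hp' hc n j)
  rw [hs.hasSum_iff_tendsto_nat]
  simp only [key]
  have ht : Tendsto (fun n : ℕ => z ^ n * (twistedStep p c)^[n] g j) atTop (nhds 0) := by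
    refine squeeze_zero_norm (a := fun n => z ^ n * M) (fun n => ?_) ?_
    · rw [norm_mul, norm_pow, Real.norm_of_nonneg hz]
      exact mul_le_mul_of_nonneg_left (abs_twistedStep_iterate_le hp hp' hc hg n j)
        (by positivity)
    · simpa using (tendsto_pow_atTop_nhds_zero_of_lt_one hz hz1).mul_const M
  simpa using tendsto_const_nhds.sub ht

theorem finite_support_twistedStep {f : ℤ → ℝ} (hf : f.support.Finite) :
    (twistedStep p c f).support.Finite := by
  have h1 : (fun j : ℤ => f (j - 1)).support.Finite :=
    hf.preimage (f := fun j : ℤ => j - 1) (sub_left_injective.injOn)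
  have h2 : (fun j : ℤ => f (j + 1)).support.Finite :=
    hf.preimage (f := fun j : ℤ => j + 1) ((add_left_injective 1).injOn)
  refine ((hf.union h1).union h2).subset fun j hj => ?_
  by_contra h
  simp only [Set.mem_union, Function.mem_support, not_or, not_not] at h
  apply hj
  simp [twistedStep, h.1.1, h.1.2, h.2]

theorem finite_support_twistedIter (n : ℕ) : (twistedIter p c n).support.Finite := by
  induction n with
  | zero =>
    refine (Set.finite_singleton (0 : ℤ)).subset fun j hj => ?_
    by_contra h
    exact hj (by simp [twistedIter_zero, Pi.single_eq_of_ne (show j ≠ 0 from h)])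
  | succ n ih =>
    rw [twistedIter_succ]
    exact finite_support_twistedStep ih

theorem summable_of_finite_support_imp {f g : ℤ → ℝ} (hf : f.support.Finite)
    (h : ∀ j, f j = 0 → g j = 0) : Summable g := by
  refine summable_of_hasFiniteSupport (hf.subset fun j hj => ?_)
  exact fun h0 => hj (h j h0)

/-- Dividing by `p j` removes the coefficient of the vertical steps, and the two shifts are adjoint
to each other. -/
theorem tsum_twistedStep_mul_div (hp : ∀ j, p j ≠ 0) {f g : ℤ → ℝ} (hf : f.support.Finite)
    (hg : g.support.Finite) :
    ∑' j, twistedStep p c f j * g j / p j = ∑' j, f j * twistedStep p c g j / p j := by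
  have aux : ∀ {f g : ℤ → ℝ}, f.support.Finite → g.support.Finite →
      ∑' j, twistedStep p c f j * g j / p j =
        ∑' j, (1 - 2 * p j) * c * (f j * g j) / p j + ∑' j, f (j - 1) * g j +
          ∑' j, f (j + 1) * g j := by
    intro f g hf hg
    have s1 : Summable fun j => (1 - 2 * p j) * c * (f j * g j) / p j :=
      summable_of_finite_support_imp hg fun j hj => by simp [hj]
    have s2 : Summable fun j => f (j - 1) * g j :=
      summable_of_finite_support_imp hg fun j hj => by simp [hj]
    have s3 : Summable fun j => f (j + 1) * g j :=
      summable_of_finite_support_imp hg fun j hj => by simp [hj]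
    rw [← s1.tsum_add s2, ← (s1.add s2).tsum_add s3]
    refine tsum_congr fun j => ?_
    have := hp j
    unfold twistedStep
    field_simp
    ring
  have e : ∀ f g : ℤ → ℝ, ∑' j, f (j - 1) * g j = ∑' j, g (j + 1) * f j := by
    intro f g
    rw [← (Equiv.addRight (1 : ℤ)).tsum_eq fun j => f (j - 1) * g j]
    refine tsum_congr fun j => ?_
    simp [mul_comm]
  have h1 := aux hf hg
  have h2 := aux hg hf
  rw [e] at h1 h2
  have h3 : ∑' j, f j * twistedStep p c g j / p j = ∑' j, twistedStep p c g j * f j / p j :=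
    tsum_congr fun j => by rw [mul_comm]
  rw [h3, h1, h2]
  simp only [mul_comm (g _) (f _)]
  ring

/-- Jensen pointwise, then invariance of the weight: `1 / p j = (1 - 2 * p j) / p j + 1 + 1`, where
the two units absorb the shifted sums. -/
theorem tsum_twistedStep_sq_div_le (hp : ∀ j, 0 < p j) (hp' : ∀ j, p j ≤ 1 / 2) (hc : |c| ≤ 1)
    {f : ℤ → ℝ} (hf : f.support.Finite) :
    ∑' j, twistedStep p c f j ^ 2 / p j ≤ ∑' j, f j ^ 2 / p j := by
  have s1 : Summable fun j => (1 - 2 * p j) * f j ^ 2 / p j :=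
    summable_of_finite_support_imp hf fun j hj => by simp [hj]
  have s0 : Summable fun j => f j ^ 2 :=
    summable_of_finite_support_imp hf fun j hj => by simp [hj]
  have s2 : Summable fun j => f (j - 1) ^ 2 :=
    summable_comp_add_int s0 (-1)
  have s3 : Summable fun j => f (j + 1) ^ 2 :=
    summable_comp_add_int s0 1
  have e2 : ∑' j, f (j - 1) ^ 2 = ∑' j, f j ^ 2 :=
    tsum_comp_add_int (fun j => f j ^ 2) (-1)
  have e3 : ∑' j, f (j + 1) ^ 2 = ∑' j, f j ^ 2 :=
    tsum_comp_add_int (fun j => f j ^ 2) 1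
  have h1 : ∑' j, f j ^ 2 / p j = ∑' j, (1 - 2 * p j) * f j ^ 2 / p j + ∑' j, f (j - 1) ^ 2 +
      ∑' j, f (j + 1) ^ 2 := by
    rw [e2, e3, ← s1.tsum_add s0, ← (s1.add s0).tsum_add s0]
    refine tsum_congr fun j => ?_
    have := (hp j).ne'
    field_simp
    ring
  rw [h1, ← s1.tsum_add s2, ← (s1.add s2).tsum_add s3]
  refine Summable.tsum_le_tsum (fun j => ?_)
    (summable_of_finite_support_imp (finite_support_twistedStep (p := p) (c := c) hf)
      fun j hj => by simp [hj]) ((s1.add s2).add s3)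
  have h0 := hp j
  rw [div_le_iff₀ h0, add_mul, add_mul, div_mul_cancel₀ _ h0.ne']
  unfold twistedStep
  linarith [sq_convex_comb_le h0.le (hp' j) hc (f j) (f (j - 1)) (f (j + 1))]

theorem tsum_twistedIter_mul (hp : ∀ j, p j ≠ 0) (m n : ℕ) :
    ∑' j, twistedIter p c (m + n) j * twistedIter p c 0 j / p j =
      ∑' j, twistedIter p c m j * twistedIter p c n j / p j := by
  induction n generalizing m with
  | zero => rfl
  | succ n ih =>
    rw [show m + (n + 1) = (m + 1) + n by ring, ih (m + 1), twistedIter_succ, twistedIter_succ,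
      tsum_twistedStep_mul_div hp (finite_support_twistedIter m) (finite_support_twistedIter n)]

/-- By self-adjointness the even diagonal entries are squared norms, which the contraction makes
decreasing. -/
theorem twistedIter_two_mul (hp : ∀ j, p j ≠ 0) (n : ℕ) :
    twistedIter p c (2 * n) 0 / p 0 = ∑' j, twistedIter p c n j ^ 2 / p j := by
  have h := tsum_twistedIter_mul (c := c) hp n n
  rw [← two_mul, tsum_eq_single 0] at h
  · simpa [twistedIter_zero, sq] using h
  · intro j hj
    simp [twistedIter_zero, hj]

theorem antitone_twistedIter_two_mul (hp : ∀ j, 0 < p j) (hp' : ∀ j, p j ≤ 1 / 2)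
    (hc : |c| ≤ 1) : Antitone fun n => twistedIter p c (2 * n) 0 := by
  refine antitone_nat_of_succ_le fun n => ?_
  rw [← div_le_div_iff_of_pos_right (hp 0), twistedIter_two_mul (fun j => (hp j).ne'),
    twistedIter_two_mul (fun j => (hp j).ne'), twistedIter_succ]
  exact tsum_twistedStep_sq_div_le hp hp' hc (finite_support_twistedIter n)

end twisted

/-! ### Monotonicity of the even return probabilities. -/

namespace IsAnisotropicWalk

variable {Ω : Type*} [MeasurableSpace Ω] {μ : Measure Ω} [IsProbabilityMeasure μ]
  {p : ℤ → ℝ} {C : ℕ → Ω → ℤ × ℤ}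

theorem measureReal_origin_eq_integral (hC : IsAnisotropicWalk μ p C) (hp : ∀ j, p j ≠ 0)
    (N : ℕ) : μ.real {ω | C N ω = (0, 0)} =
      Real.pi⁻¹ * ∫ θ in (0 : ℝ)..Real.pi, twistedIter p (Real.cos θ) N 0 := by
  simpa [hp 0] using hC.measureReal_eq_integral hp N 0 0

theorem antitone_measureReal_origin (hC : IsAnisotropicWalk μ p C) (hp : ∀ j, 0 < p j)
    (hp' : ∀ j, p j ≤ 1 / 2) : Antitone fun N => μ.real {ω | C (2 * N) ω = (0, 0)} := by
  intro m n hmn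
  simp only [hC.measureReal_origin_eq_integral (fun j => (hp j).ne')]
  refine mul_le_mul_of_nonneg_left ?_ (by positivity)
  refine intervalIntegral.integral_mono_on Real.pi_pos.le
    (((continuous_twistedIter p _ 0).comp Real.continuous_cos).intervalIntegrable _ _)
    (((continuous_twistedIter p _ 0).comp Real.continuous_cos).intervalIntegrable _ _)
    fun θ _ => antitone_twistedIter_two_mul hp hp' (Real.abs_cos_le_one θ) hmn

end IsAnisotropicWalk

/-! ### The explicit Green function of the HPHC walk. -/

theorem hphcParam_pos (j : ℤ) : 0 < hphcParam j := by
  unfold hphcParam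
  split_ifs <;> norm_num

theorem hphcParam_le (j : ℤ) : hphcParam j ≤ 1 / 2 := by
  unfold hphcParam
  split_ifs <;> norm_num

/-- Four times the inverse of the Green function, at the origin and at horizontal frequency of
cosine `c`, of the HPHC walk. -/
noncomputable def hphcDenom (z c : ℝ) : ℝ :=
  1 - z * c + √(1 - z ^ 2) + √((2 - z * c) ^ 2 - z ^ 2)

theorem mul_le_of_abs_le_one {z c : ℝ} (hz : 0 ≤ z) (hc : |c| ≤ 1) : z * c ≤ z :=
  mul_le_of_le_one_right hz (abs_le.1 hc).2

theorem hphcDenom_pos {z c : ℝ} (hz : 0 ≤ z) (hz1 : z < 1) (hc : |c| ≤ 1) :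
    0 < hphcDenom z c := by
  have := mul_le_of_abs_le_one hz hc
  have := Real.sqrt_nonneg (1 - z ^ 2)
  have := Real.sqrt_nonneg ((2 - z * c) ^ 2 - z ^ 2)
  unfold hphcDenom
  linarith

/-- The bounded solution is `K a ^ j` above and `K b ^ (-j)` below, where `a`, `b` are the roots in
`[0, 1]` of `z a² - 2 (2 - z c) a + z = 0` and `z b² - 2 b + z = 0`; the equation at `0` fixes `K`.
-/
theorem hasSum_pow_mul_twistedIter_hphcParam {z c : ℝ} (hz : 0 ≤ z) (hz1 : z < 1)
    (hc : |c| ≤ 1) :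
    HasSum (fun n => z ^ n * twistedIter hphcParam c n 0) (4 / hphcDenom z c) := by
  have hD := hphcDenom_pos hz hz1 hc
  have hzc := mul_le_of_abs_le_one hz hc
  obtain ⟨y, hy⟩ : ∃ y, y = 2 - z * c := ⟨_, rfl⟩
  obtain ⟨B, hB⟩ : ∃ B, B = √(y ^ 2 - z ^ 2) := ⟨_, rfl⟩
  obtain ⟨d, hd⟩ : ∃ d, d = √(1 - z ^ 2) := ⟨_, rfl⟩
  have hB0 : 0 ≤ B := hB ▸ Real.sqrt_nonneg _
  have hd0 : 0 ≤ d := hd ▸ Real.sqrt_nonneg _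
  have hB2 : B ^ 2 = y ^ 2 - z ^ 2 := by rw [hB, Real.sq_sqrt]; nlinarith
  have hd2 : d ^ 2 = 1 - z ^ 2 := by rw [hd, Real.sq_sqrt]; nlinarith
  have hy1 : 1 < y := by linarith
  -- The smaller roots `(y - B) / z` and `(1 - d) / z` in rationalised form, which is also valid at
  -- `z = 0`.
  obtain ⟨a, ha⟩ : ∃ a, a = z / (y + B) := ⟨_, rfl⟩
  obtain ⟨b, hb⟩ : ∃ b, b = z / (1 + d) := ⟨_, rfl⟩
  have hyB : y + B ≠ 0 := by positivity
  have h1d : 1 + d ≠ 0 := by positivity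
  have ha1 : a * (y + B) = z := by rw [ha, div_mul_cancel₀ _ hyB]
  have hb1 : b * (1 + d) = z := by rw [hb, div_mul_cancel₀ _ h1d]
  have hza : z * a = y - B := by
    rw [ha]
    field_simp
    linear_combination hB2
  have hzb : z * b = 1 - d := by
    rw [hb]
    field_simp
    linear_combination hd2
  have ha0 : 0 ≤ a := by rw [ha]; positivity
  have hb0 : 0 ≤ b := by rw [hb]; positivity
  have ha2 : a ≤ 1 := by rw [ha, div_le_one (by positivity)]; linarith
  have hb2 : b ≤ 1 := by rw [hb, div_le_one (by positivity)]; linarith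
  obtain ⟨K, hK⟩ : ∃ K, K = 4 / hphcDenom z c := ⟨_, rfl⟩
  have hK1 : K * (1 - z * c + d + B) = 4 := by
    rw [hK, hd, hB, hy]
    exact div_mul_cancel₀ _ hD.ne'
  have hK0 : 0 ≤ K := by rw [hK]; positivity
  have hqa : z * a ^ 2 - 2 * y * a + z = 0 := by linear_combination a * hza - ha1
  have hqb : z * b ^ 2 - 2 * b + z = 0 := by linear_combination b * hzb - hb1
  have key := hasSum_pow_mul_twistedIter (p := hphcParam) (c := c)
    (fun j => (hphcParam_pos j).le) hphcParam_le hc hz hz1 (M := K)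
    (g := fun j => if 0 ≤ j then K * a ^ j.toNat else K * b ^ (-j).toNat) ?_ ?_ 0
  · rw [← hK]
    simpa using key
  · intro j
    split_ifs
    · rw [abs_of_nonneg (by positivity)]
      exact mul_le_of_le_one_right hK0 (pow_le_one₀ ha0 ha2)
    · rw [abs_of_nonneg (by positivity)]
      exact mul_le_of_le_one_right hK0 (pow_le_one₀ hb0 hb2)
  · intro j
    rcases lt_trichotomy j 0 with hj | rfl | hj
    · obtain ⟨n, rfl⟩ : ∃ n : ℕ, j = -(n + 1 : ℤ) := ⟨(-j - 1).toNat, by omega⟩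
      -- For `n = 0` the upper neighbour is the origin and falls in the other branch; both branches
      -- give `K` there.
      have e0 : (if (0 : ℤ) ≤ -(n + 1 : ℤ) + 1 then K * a ^ (-(n + 1 : ℤ) + 1).toNat
          else K * b ^ (-(-(n + 1 : ℤ) + 1)).toNat) = K * b ^ n := by
        rcases n with _ | n
        · simp
        · rw [if_neg (by push_cast; omega),
            show (-(-((n + 1 : ℕ) + 1 : ℤ) + 1)).toNat = n + 1 by omega]
      simp only [twistedStep]
      rw [e0]
      simp only [hphcParam]
      rw [if_neg (by omega), if_neg (by omega), if_neg (by omega),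
        show (-(-(n + 1 : ℤ))).toNat = n + 1 by omega,
        show (-(-(n + 1 : ℤ) - 1)).toNat = n + 2 by omega,
        Pi.single_eq_of_ne (by omega)]
      rw [pow_succ, pow_add]
      linear_combination (-K * b ^ n / 2) * hqb
    · simp only [twistedStep, hphcParam, Pi.single_eq_same]
      norm_num
      linear_combination (1 / 4 : ℝ) * hK1 - K / 4 * hza - K / 4 * hzb - K / 4 * hy
    · obtain ⟨n, rfl⟩ : ∃ n : ℕ, j = (n + 1 : ℤ) := ⟨(j - 1).toNat, by omega⟩
      simp only [twistedStep, hphcParam]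
      rw [if_pos (by omega), if_pos (by omega), if_pos (by omega), if_pos (by omega),
        show ((n + 1 : ℤ)).toNat = n + 1 by omega,
        show ((n + 1 : ℤ) - 1).toNat = n by omega,
        show ((n + 1 : ℤ) + 1).toNat = n + 2 by omega,
        Pi.single_eq_of_ne (by omega)]
      rw [pow_succ, pow_add]
      linear_combination (-K * a ^ n / 4) * hqa + (-K * a ^ n / 4) * 2 * a * hy

theorem continuous_hphcDenom (z : ℝ) : Continuous (hphcDenom z) := by
  unfold hphcDenom
  fun_prop

/-! ### The generating function of the return probabilities. -/

namespace IsHPHCWalk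

variable {Ω : Type*} [MeasurableSpace Ω] {μ : Measure Ω} [IsProbabilityMeasure μ]
  {C : ℕ → Ω → ℤ × ℤ}

theorem hasSum_return (hC : IsHPHCWalk μ C) {z : ℝ} (hz : 0 ≤ z) (hz1 : z < 1) :
    HasSum (fun N => μ.real {ω | C N ω = (0, 0)} * z ^ N)
      (Real.pi⁻¹ * ∫ θ in (0 : ℝ)..Real.pi, 4 / hphcDenom z (Real.cos θ)) := by
  have h : HasSum (fun N => ∫ θ in (0 : ℝ)..Real.pi,
      z ^ N * twistedIter hphcParam (Real.cos θ) N 0)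
      (∫ θ in (0 : ℝ)..Real.pi, 4 / hphcDenom z (Real.cos θ)) := by
    refine intervalIntegral.hasSum_integral_of_dominated_convergence (fun N _ => z ^ N)
      (fun N => ?_) (fun N => ae_of_all _ fun θ _ => ?_)
      (ae_of_all _ fun θ _ => summable_geometric_of_lt_one hz hz1)
      (continuous_const.intervalIntegrable _ _)
      (ae_of_all _ fun θ _ =>
        hasSum_pow_mul_twistedIter_hphcParam hz hz1 (Real.abs_cos_le_one θ))
    · exact (continuous_const.mul
        ((continuous_twistedIter hphcParam N 0).comp Real.continuous_cos)).aestronglyMeasurable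
    · rw [norm_mul, norm_pow, Real.norm_of_nonneg hz]
      exact mul_le_of_le_one_right (by positivity) (abs_twistedIter_le_one
        (fun j => (hphcParam_pos j).le) hphcParam_le (Real.abs_cos_le_one θ) N 0)
  have e : ∀ N, μ.real {ω | C N ω = (0, 0)} * z ^ N = Real.pi⁻¹ *
      ∫ θ in (0 : ℝ)..Real.pi, z ^ N * twistedIter hphcParam (Real.cos θ) N 0 := by
    intro N
    rw [IsAnisotropicWalk.measureReal_origin_eq_integral hC (fun j => (hphcParam_pos j).ne'),
      intervalIntegral.integral_const_mul]
    ring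
  simp only [e]
  exact h.mul_left Real.pi⁻¹

theorem hasSum_return_even (hC : IsHPHCWalk μ C) {w : ℝ} (hw : 0 ≤ w) (hw1 : w < 1) :
    HasSum (fun N => μ.real {ω | C (2 * N) ω = (0, 0)} * w ^ N)
      (Real.pi⁻¹ * ∫ θ in (0 : ℝ)..Real.pi, 4 / hphcDenom (√w) (Real.cos θ)) := by
  have hz1 : √w < 1 := (Real.sqrt_lt' one_pos).2 (by simpa using hw1)
  have h := hC.hasSum_return (Real.sqrt_nonneg w) hz1
  have hi : Function.Injective fun N : ℕ => 2 * N := fun a b hab => by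
    simpa using hab
  rw [← hi.hasSum_iff] at h
  · simpa only [Function.comp_def, pow_mul, Real.sq_sqrt hw] using h
  · intro N hN
    have : Odd N := by
      rw [← Nat.not_even_iff_odd]
      rintro ⟨m, rfl⟩
      exact hN ⟨m, two_mul m⟩
    rw [IsAnisotropicWalk.measureReal_eq_zero_of_odd hC N 0 0 (by simpa using this), zero_mul]

end IsHPHCWalk

/-! ### The logarithmic singularity of the generating function at `1`. -/

section asymptotics

theorem cos_le_one_sub_sq_add_pow_four (θ : ℝ) : Real.cos θ ≤ 1 - θ ^ 2 / 2 + θ ^ 4 / 2 := by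
  rcases le_total |θ| 1 with h | h
  · have := (abs_le.1 (Real.cos_bound h)).2
    rw [show |θ| ^ 4 = θ ^ 4 by rw [pow_abs, abs_of_nonneg (by positivity)]] at this
    nlinarith [sq_nonneg (θ ^ 2)]
  · have h2 : 1 ≤ θ ^ 2 := by
      rw [← sq_abs]
      nlinarith
    nlinarith [Real.cos_le_one θ]

/-- The small-frequency approximation of `hphcDenom (√(1 - δ ^ 2)) (Real.cos θ)`. -/
noncomputable def hphcDenomApprox (δ θ : ℝ) : ℝ := δ + √(2 * δ ^ 2 + θ ^ 2)

/-- Compares the radicands of `hphcDenom` and `hphcDenomApprox`: with `t = 1 - z c` the exact one is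
`(1 + t) ^ 2 - z ^ 2`, and the terms of first order in `1 - z ^ 2` and `θ ^ 2` cancel. -/
theorem abs_sub_le_two_mul_sq {z c θ t : ℝ} (hz : 0 ≤ z) (hz1 : z ≤ 1)
    (hc1 : 1 - θ ^ 2 / 2 ≤ c) (hc2 : c ≤ 1 - θ ^ 2 / 2 + θ ^ 4 / 2) (ht : t = 1 - z * c)
    (ht0 : 0 ≤ t) (ht1 : t ≤ (1 - z ^ 2) + θ ^ 2) :
    |((1 - z ^ 2) + 2 * t + t ^ 2) - (2 * (1 - z ^ 2) + θ ^ 2)| ≤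
      2 * ((1 - z ^ 2) + θ ^ 2) ^ 2 := by
  have hu : ((1 - z ^ 2) + 2 * t + t ^ 2) - (2 * (1 - z ^ 2) + θ ^ 2) =
      (1 - z) ^ 2 + z * (2 * (1 - c) - θ ^ 2) - (1 - z) * θ ^ 2 + t ^ 2 := by
    rw [ht]
    ring
  have ht4 : t ^ 2 ≤ ((1 - z ^ 2) + θ ^ 2) ^ 2 := pow_le_pow_left₀ ht0 ht1 2
  have hexp : ((1 - z ^ 2) + θ ^ 2) ^ 2 =
      (1 - z ^ 2) ^ 2 + 2 * ((1 - z ^ 2) * θ ^ 2) + θ ^ 4 := by ring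
  have h1z : 1 - z ≤ 1 - z ^ 2 := by nlinarith
  have h1z2 : (1 - z) ^ 2 ≤ (1 - z ^ 2) ^ 2 := pow_le_pow_left₀ (by linarith) h1z 2
  have hθz : (1 - z) * θ ^ 2 ≤ (1 - z ^ 2) * θ ^ 2 :=
    mul_le_mul_of_nonneg_right h1z (sq_nonneg θ)
  have hθz0 : 0 ≤ (1 - z) * θ ^ 2 := mul_nonneg (by linarith) (sq_nonneg θ)
  have hθ4 : 0 ≤ θ ^ 4 := by positivity
  have hv : z * (2 * (1 - c) - θ ^ 2) ≤ 0 :=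
    mul_nonpos_of_nonneg_of_nonpos hz (by linarith)
  have hv2 : 0 ≤ (1 - z) * -(2 * (1 - c) - θ ^ 2) := mul_nonneg (by linarith) (by linarith)
  have hs1 := sq_nonneg (1 - z)
  have hs2 := sq_nonneg t
  have hs3 := sq_nonneg (1 - z ^ 2)
  rw [hu, abs_le]
  constructor <;> linarith

theorem abs_sub_le_of_abs_sq_sub_le {X Y r K : ℝ} (hX : 0 ≤ X) (hr : 0 < r) (hY : r ≤ Y)
    (h : |X ^ 2 - Y ^ 2| ≤ K * r) : |X - Y| ≤ K := by
  refine le_of_mul_le_mul_right ?_ hr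
  calc |X - Y| * r ≤ |X - Y| * (X + Y) :=
        mul_le_mul_of_nonneg_left (by linarith) (abs_nonneg _)
    _ = |X ^ 2 - Y ^ 2| := by
        rw [show X ^ 2 - Y ^ 2 = (X - Y) * (X + Y) by ring, abs_mul,
          abs_of_nonneg (show 0 ≤ X + Y by linarith)]
    _ ≤ K * r := h

theorem cos_le_one_sub_sq_div_eight {θ : ℝ} (hθ : |θ| ≤ Real.pi) :
    Real.cos θ ≤ 1 - θ ^ 2 / 8 := by
  have h := Real.cos_le_one_sub_mul_cos_sq hθ
  have h8 : 1 / 8 ≤ 2 / Real.pi ^ 2 := by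
    rw [div_le_div_iff₀ (by norm_num) (by positivity)]
    nlinarith [Real.pi_le_four, Real.pi_pos]
  nlinarith [mul_le_mul_of_nonneg_right h8 (sq_nonneg θ)]

/-- With `r² = 1 - z² + θ²`, the two denominators differ by at most `11 r²` and each is of order at
least `r` (constants `1/3` and `1`), so the reciprocals differ by a bounded amount. This is the
domination for the limit `z → 1`. -/
theorem abs_inv_hphcDenom_sub_le {z θ : ℝ} (hz : 1 / 2 ≤ z) (hz1 : z < 1)
    (hθ : |θ| ≤ Real.pi) :
    |1 / hphcDenom z (Real.cos θ) - 1 / hphcDenomApprox (√(1 - z ^ 2)) θ| ≤ 33 := by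
  have hz2 : 0 < 1 - z ^ 2 := by nlinarith
  have hδ2 : √(1 - z ^ 2) ^ 2 = 1 - z ^ 2 := Real.sq_sqrt hz2.le
  have hδ0 : 0 < √(1 - z ^ 2) := Real.sqrt_pos.2 hz2
  have hc1 := Real.one_sub_sq_div_two_le_cos (x := θ)
  have hc2 := cos_le_one_sub_sq_add_pow_four θ
  have hc3 := cos_le_one_sub_sq_div_eight hθ
  have hc4 := Real.cos_le_one θ
  unfold hphcDenom hphcDenomApprox
  rw [hδ2]
  generalize √(1 - z ^ 2) = δ at *
  generalize Real.cos θ = c at *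
  obtain ⟨t, ht⟩ : ∃ t, t = 1 - z * c := ⟨_, rfl⟩
  obtain ⟨r, hr⟩ : ∃ r, r = √((1 - z ^ 2) + θ ^ 2) := ⟨_, rfl⟩
  have hr2 : r ^ 2 = (1 - z ^ 2) + θ ^ 2 := by rw [hr, Real.sq_sqrt]; positivity
  have hr0 : 0 < r := by rw [hr]; exact Real.sqrt_pos.2 (by positivity)
  have hθ16 : θ ^ 2 ≤ 16 := by
    rw [← sq_abs]
    nlinarith [abs_nonneg θ, Real.pi_le_four]
  have hr5 : r ≤ 5 := by
    refine (sq_le_sq₀ hr0.le (by norm_num)).1 ?_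
    nlinarith
  have hθ2 := sq_nonneg θ
  have ht0 : θ ^ 2 / 16 ≤ t := by
    -- The only use of `1 / 2 ≤ z` : it keeps the `θ` dependence of `t = (1 - z) + z (1 - c)`.
    have := mul_le_mul hz (show θ ^ 2 / 8 ≤ 1 - c by linarith) (by positivity) (by linarith)
    rw [ht]
    linarith
  have ht00 : 0 ≤ t := (by positivity : (0 : ℝ) ≤ θ ^ 2 / 16).trans ht0
  have ht1 : t ≤ (1 - z ^ 2) + θ ^ 2 := by
    have h1 : z * (1 - c) ≤ 1 * (θ ^ 2 / 2) :=
      mul_le_mul hz1.le (by linarith) (by linarith) zero_le_one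
    have h2 : z * z ≤ 1 * z := mul_le_mul_of_nonneg_right hz1.le (by linarith)
    rw [ht]
    linarith
  have hX : (2 - z * c) ^ 2 - z ^ 2 = (1 - z ^ 2) + 2 * t + t ^ 2 := by rw [ht]; ring
  rw [hX, ← ht]
  obtain ⟨X, hXd⟩ : ∃ X, X = √((1 - z ^ 2) + 2 * t + t ^ 2) := ⟨_, rfl⟩
  obtain ⟨Y, hYd⟩ : ∃ Y, Y = √(2 * (1 - z ^ 2) + θ ^ 2) := ⟨_, rfl⟩
  rw [← hXd, ← hYd]
  have hX0 : 0 ≤ X := hXd ▸ Real.sqrt_nonneg _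
  have hY0 : 0 ≤ Y := hYd ▸ Real.sqrt_nonneg _
  have hX2 : X ^ 2 = (1 - z ^ 2) + 2 * t + t ^ 2 := by rw [hXd, Real.sq_sqrt]; positivity
  have hY2 : Y ^ 2 = 2 * (1 - z ^ 2) + θ ^ 2 := by rw [hYd, Real.sq_sqrt]; positivity
  have hXr : r / 3 ≤ X := by
    refine (sq_le_sq₀ (by positivity) hX0).1 ?_
    rw [div_pow, hr2, hX2]
    linarith [sq_nonneg t]
  have hYr : r ≤ Y := by
    refine (sq_le_sq₀ hr0.le hY0).1 ?_
    rw [hr2, hY2]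
    linarith
  have hXY : |X - Y| ≤ 10 * r ^ 2 := by
    have h1 := abs_sub_le_two_mul_sq (by linarith) hz1.le hc1 hc2 ht ht00 ht1
    rw [← hX2, ← hY2, ← hr2] at h1
    have h2 : |X - Y| ≤ 2 * r ^ 3 := abs_sub_le_of_abs_sq_sub_le hX0 hr0 hYr (by linarith)
    have h3 := mul_le_mul_of_nonneg_right hr5 (sq_nonneg r)
    linarith
  have hD : 0 < t + δ + X := by positivity
  have hD0 : 0 < δ + Y := by positivity
  rw [div_sub_div _ _ hD.ne' hD0.ne', abs_div, abs_of_pos (mul_pos hD hD0),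
    div_le_iff₀ (mul_pos hD hD0)]
  have hprod : r / 3 * r ≤ (t + δ + X) * (δ + Y) :=
    mul_le_mul (by linarith) (by linarith) hr0.le hD.le
  have habs : |1 * (δ + Y) - (t + δ + X) * 1| ≤ 11 * r ^ 2 := by
    rw [show 1 * (δ + Y) - (t + δ + X) * 1 = -(t + (X - Y)) by ring, abs_neg]
    refine (abs_add_le _ _).trans ?_
    rw [abs_of_nonneg ht00]
    linarith
  linarith

theorem continuous_hphcDenomApprox (δ : ℝ) : Continuous (hphcDenomApprox δ) := by
  unfold hphcDenomApprox
  fun_prop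

theorem hphcDenomApprox_pos {δ : ℝ} (hδ : 0 < δ) (θ : ℝ) : 0 < hphcDenomApprox δ θ :=
  add_pos_of_pos_of_nonneg hδ (Real.sqrt_nonneg _)

theorem tendsto_sqrt_one_sub_nhdsLT_one :
    Tendsto (fun w : ℝ => √(1 - w)) (nhdsWithin 1 (Set.Iio 1)) (nhdsWithin 0 (Set.Ioi 0)) := by
  refine tendsto_nhdsWithin_iff.2 ⟨?_, ?_⟩
  · have h : Continuous fun w : ℝ => √(1 - w) := by fun_prop
    simpa using (h.tendsto 1).mono_left nhdsWithin_le_nhds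
  · filter_upwards [self_mem_nhdsWithin] with w hw
    have hw : w < 1 := hw
    exact Real.sqrt_pos.2 (by linarith)

theorem tendsto_integral_inv_hphcDenom_sub :
    Tendsto (fun w : ℝ => ∫ θ in (0 : ℝ)..Real.pi,
      (1 / hphcDenom (√w) (Real.cos θ) - 1 / hphcDenomApprox (√(1 - w)) θ))
      (nhdsWithin 1 (Set.Iio 1))
      (nhds (∫ θ in (0 : ℝ)..Real.pi,
        (1 / hphcDenom 1 (Real.cos θ) - 1 / hphcDenomApprox 0 θ))) := by
  have hw : ∀ᶠ w : ℝ in nhdsWithin 1 (Set.Iio 1), 1 / 4 < w ∧ w < 1 :=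
    (eventually_nhdsWithin_of_eventually_nhds (lt_mem_nhds (by norm_num))).and
      self_mem_nhdsWithin
  refine intervalIntegral.tendsto_integral_filter_of_dominated_convergence (fun _ => 33)
    ?_ ?_ (continuous_const.intervalIntegrable _ _) ?_
  · refine Eventually.of_forall fun w => ?_
    have h1 : Measurable fun θ => hphcDenom (√w) (Real.cos θ) :=
      ((continuous_hphcDenom _).comp Real.continuous_cos).measurable
    have h2 := (continuous_hphcDenomApprox (√(1 - w))).measurable
    exact ((measurable_const.div h1).sub (measurable_const.div h2)).aestronglyMeasurable
  · filter_upwards [hw] with w hw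
    refine ae_of_all _ fun θ hθ => ?_
    rw [Set.uIoc_of_le Real.pi_pos.le] at hθ
    have h1 : 1 / 2 ≤ √w := Real.le_sqrt_of_sq_le (by norm_num; linarith)
    have h2 : √w < 1 := (Real.sqrt_lt' one_pos).2 (by linarith)
    have h := abs_inv_hphcDenom_sub_le h1 h2
      (by rw [abs_of_pos hθ.1]; exact hθ.2)
    rwa [Real.sq_sqrt (by linarith)] at h
  · refine ae_of_all _ fun θ hθ => ?_
    rw [Set.uIoc_of_le Real.pi_pos.le] at hθ
    have hcos : Real.cos θ < 1 := by
      rw [← Real.cos_zero]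
      exact Real.cos_lt_cos_of_nonneg_of_le_pi le_rfl hθ.2 hθ.1
    have hD : hphcDenom (√1) (Real.cos θ) ≠ 0 := by
      have h1 := Real.sqrt_nonneg (1 - √1 ^ 2)
      have h2 := Real.sqrt_nonneg ((2 - √1 * Real.cos θ) ^ 2 - √1 ^ 2)
      refine ne_of_gt ?_
      rw [hphcDenom]
      rw [Real.sqrt_one] at h1 h2 ⊢
      linarith
    have hA : hphcDenomApprox (√(1 - 1)) θ ≠ 0 := by
      rw [sub_self, Real.sqrt_zero, hphcDenomApprox]
      refine ne_of_gt (add_pos_of_nonneg_of_pos le_rfl (Real.sqrt_pos.2 ?_))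
      have := hθ.1
      positivity
    have hc : ContinuousAt (fun w : ℝ => 1 / hphcDenom (√w) (Real.cos θ) -
        1 / hphcDenomApprox (√(1 - w)) θ) 1 := by
      refine ContinuousAt.sub (ContinuousAt.div continuousAt_const ?_ hD)
        (ContinuousAt.div (f := fun _ => (1 : ℝ))
          (g := fun w : ℝ => hphcDenomApprox (√(1 - w)) θ) continuousAt_const ?_ hA)
      · unfold hphcDenom
        fun_prop
      · unfold hphcDenomApprox
        fun_prop
    have := hc.tendsto.mono_left (nhdsWithin_le_nhds (s := Set.Iio 1))
    simpa only [Real.sqrt_one, sub_self, Real.sqrt_zero] using this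

/-- Since `s ≤ √(2 + s²) ≤ s + 2`, the difference is at most `2 / (1 + s²)`. -/
theorem integrableOn_inv_hphcDenomApprox_one_sub :
    IntegrableOn (fun s : ℝ => 1 / hphcDenomApprox 1 s - 1 / (1 + s)) (Set.Ioi 0) := by
  refine Integrable.mono' ((integrable_inv_one_add_sq.const_mul 2).integrableOn) ?_ ?_
  · have h2 := (continuous_hphcDenomApprox 1).measurable
    exact ((measurable_const.div h2).sub
      (measurable_const.div (measurable_const.add measurable_id))).aestronglyMeasurable
  · filter_upwards [ae_restrict_mem measurableSet_Ioi] with s hs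
    have hs : 0 < s := hs
    obtain ⟨Y, hY⟩ : ∃ Y, Y = √(2 * 1 ^ 2 + s ^ 2) := ⟨_, rfl⟩
    have hY0 : 0 ≤ Y := hY ▸ Real.sqrt_nonneg _
    have hY2 : Y ^ 2 = 2 + s ^ 2 := by
      rw [hY, Real.sq_sqrt (by positivity)]
      ring
    have h1 : s ≤ Y := (sq_le_sq₀ hs.le hY0).1 (by linarith)
    have h2 : Y ≤ s + 2 := (sq_le_sq₀ hY0 (by positivity)).1 (by nlinarith)
    rw [hphcDenomApprox, ← hY, div_sub_div _ _ (by positivity) (by positivity), Real.norm_eq_abs,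
      abs_div, abs_of_pos (show 0 < (1 + Y) * (1 + s) by positivity), ← div_eq_mul_inv,
      div_le_div_iff₀ (by positivity) (by positivity),
      abs_of_nonpos (by linarith)]
    have h3 : 1 + s ^ 2 ≤ (1 + Y) * (1 + s) := by nlinarith
    exact mul_le_mul (by linarith) h3 (by positivity) (by norm_num)

/-- By homogeneity, `θ = δ s` turns the integral into one of a fixed integrable function over `(0, π
/ δ)`. -/
theorem tendsto_integral_inv_hphcDenomApprox_sub :
    Tendsto (fun δ : ℝ => ∫ θ in (0 : ℝ)..Real.pi, (1 / hphcDenomApprox δ θ - 1 / (δ + θ)))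
      (nhdsWithin 0 (Set.Ioi 0))
      (nhds (∫ s in Set.Ioi (0 : ℝ), (1 / hphcDenomApprox 1 s - 1 / (1 + s)))) := by
  have hlim : Tendsto (fun δ : ℝ => Real.pi / δ) (nhdsWithin 0 (Set.Ioi 0)) atTop := by
    simp only [div_eq_mul_inv]
    exact tendsto_inv_nhdsGT_zero.const_mul_atTop Real.pi_pos
  refine (intervalIntegral_tendsto_integral_Ioi 0 integrableOn_inv_hphcDenomApprox_one_sub
    hlim).congr' ?_
  filter_upwards [self_mem_nhdsWithin] with δ hδ
  have hδ : 0 < δ := hδ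
  have h := intervalIntegral.integral_comp_div
    (fun s : ℝ => 1 / hphcDenomApprox 1 s - 1 / (1 + s)) hδ.ne' (a := 0) (b := Real.pi)
  rw [zero_div, smul_eq_mul, mul_comm, ← div_eq_iff hδ.ne'] at h
  rw [← h, ← intervalIntegral.integral_div]
  refine intervalIntegral.integral_congr fun θ _ => ?_
  have e1 : hphcDenomApprox δ θ = hphcDenomApprox 1 (θ / δ) * δ := by
    have e : 2 * δ ^ 2 + θ ^ 2 = (2 * 1 ^ 2 + (θ / δ) ^ 2) * δ ^ 2 := by field_simp
    rw [hphcDenomApprox, hphcDenomApprox, e, Real.sqrt_mul (by positivity), Real.sqrt_sq hδ.le]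
    ring
  have e2 : δ + θ = (1 + θ / δ) * δ := by field_simp
  simp only [e1, e2, sub_div, div_div]

/-- Telescopes through both approximations down to `1 / (δ + θ)`, whose integral is elementary; `-4
log δ = -2 log (1 - w)` is the only part that diverges as `w → 1`. -/
theorem integral_inv_hphcDenom_eq {w : ℝ} (hw1 : w < 1) :
    ∫ θ in (0 : ℝ)..Real.pi, 4 / hphcDenom (√w) (Real.cos θ) =
      4 * (∫ θ in (0 : ℝ)..Real.pi,
        (1 / hphcDenom (√w) (Real.cos θ) - 1 / hphcDenomApprox (√(1 - w)) θ)) +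
      4 * (∫ θ in (0 : ℝ)..Real.pi, (1 / hphcDenomApprox (√(1 - w)) θ - 1 / (√(1 - w) + θ))) +
      4 * Real.log (√(1 - w) + Real.pi) - 2 * Real.log (1 - w) := by
  have hδ : 0 < √(1 - w) := Real.sqrt_pos.2 (by linarith)
  have hz1 : √w < 1 := (Real.sqrt_lt' one_pos).2 (by simpa using hw1)
  have hlog : Real.log (√(1 - w)) = Real.log (1 - w) / 2 := Real.log_sqrt (by linarith)
  set δ := √(1 - w)
  have i1 : IntervalIntegrable (fun θ => 1 / hphcDenom (√w) (Real.cos θ)) volume 0 Real.pi := by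
    refine (continuous_const.div ((continuous_hphcDenom _).comp Real.continuous_cos)
      fun θ => ?_).intervalIntegrable _ _
    exact (hphcDenom_pos (Real.sqrt_nonneg w) hz1 (Real.abs_cos_le_one θ)).ne'
  have i2 : IntervalIntegrable (fun θ => 1 / hphcDenomApprox δ θ) volume 0 Real.pi :=
    (continuous_const.div (continuous_hphcDenomApprox δ) fun θ =>
      (hphcDenomApprox_pos hδ θ).ne').intervalIntegrable _ _
  have i3 : IntervalIntegrable (fun θ => 1 / (δ + θ)) volume 0 Real.pi := by
    refine ContinuousOn.intervalIntegrable ?_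
    rw [Set.uIcc_of_le Real.pi_pos.le]
    refine continuousOn_const.div (by fun_prop) fun θ hθ => ?_
    have := hθ.1
    positivity
  have e3 : ∫ θ in (0 : ℝ)..Real.pi, 1 / (δ + θ) = Real.log (δ + Real.pi) - Real.log δ := by
    rw [intervalIntegral.integral_comp_add_left (fun x => 1 / x) δ,
      integral_one_div_of_pos (by positivity) (by positivity), add_zero,
      Real.log_div (by positivity) hδ.ne']
  have e : ∀ θ : ℝ, 4 / hphcDenom (√w) (Real.cos θ) =
      4 * (1 / hphcDenom (√w) (Real.cos θ)) := fun θ => by ring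
  simp only [e]
  rw [intervalIntegral.integral_const_mul, intervalIntegral.integral_sub i1 i2,
    intervalIntegral.integral_sub i2 i3, e3, hlog]
  ring

theorem exists_tendsto_integral_inv_hphcDenom_add_log : ∃ L : ℝ,
    Tendsto (fun w : ℝ => Real.pi⁻¹ * (∫ θ in (0 : ℝ)..Real.pi,
      4 / hphcDenom (√w) (Real.cos θ)) + 2 / Real.pi * Real.log (1 - w))
      (nhdsWithin 1 (Set.Iio 1)) (nhds L) := by
  have h3 : Tendsto (fun w : ℝ => Real.log (√(1 - w) + Real.pi)) (nhdsWithin 1 (Set.Iio 1))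
      (nhds (Real.log (0 + Real.pi))) :=
    ((tendsto_nhds_of_tendsto_nhdsWithin tendsto_sqrt_one_sub_nhdsLT_one).add_const _).log
      (by simp [Real.pi_ne_zero])
  have h := (((tendsto_integral_inv_hphcDenom_sub.const_mul 4).add
    ((tendsto_integral_inv_hphcDenomApprox_sub.comp
      tendsto_sqrt_one_sub_nhdsLT_one).const_mul 4)).add (h3.const_mul 4)).const_mul Real.pi⁻¹
  refine ⟨_, h.congr' ?_⟩
  filter_upwards [self_mem_nhdsWithin] with w hw1
  rw [integral_inv_hphcDenom_eq hw1]
  simp only [Function.comp]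
  ring

end asymptotics

/-! ### A Tauberian theorem for monotone coefficients with a logarithmic singularity. -/

section tauberian

theorem hasSum_div_mul_pow (c : ℝ) {w : ℝ} (hw : 0 ≤ w) (hw1 : w < 1) :
    HasSum (fun n : ℕ => c / n * w ^ n) (-c * Real.log (1 - w)) := by
  have h := (Real.hasSum_pow_div_log_of_abs_lt_one (x := w) (by rwa [abs_of_nonneg hw])).mul_left c
  have h2 := (hasSum_nat_add_iff' (f := fun n : ℕ => c / n * w ^ n)
    (g := -c * Real.log (1 - w)) 1)
  rw [← h2]
  -- The term `n = 0` is `c / 0 = 0`.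
  simp only [Finset.range_one, Finset.sum_singleton, Nat.cast_zero, div_zero, zero_mul, sub_zero]
  have e : ∀ n : ℕ, c / ((n + 1 : ℕ) : ℝ) * w ^ (n + 1) = c * (w ^ (n + 1) / (n + 1)) := by
    intro n
    push_cast
    ring
  simp only [e]
  rw [neg_mul, ← mul_neg]
  exact h

theorem tendsto_pow_nhdsLT_one {m : ℕ} (hm : m ≠ 0) :
    Tendsto (fun w : ℝ => w ^ m) (nhdsWithin 1 (Set.Iio 1)) (nhdsWithin 1 (Set.Iio 1)) := by
  refine tendsto_nhdsWithin_iff.2 ⟨?_, ?_⟩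
  · have : ContinuousAt (fun w : ℝ => w ^ m) 1 := by fun_prop
    have h := this.tendsto
    rw [one_pow] at h
    exact h.mono_left nhdsWithin_le_nhds
  · have h1 : ∀ᶠ w : ℝ in nhdsWithin 1 (Set.Iio 1), 0 < w :=
      eventually_nhdsWithin_of_eventually_nhds (lt_mem_nhds one_pos)
    filter_upwards [h1, self_mem_nhdsWithin] with w hw hw1
    exact pow_lt_one₀ hw.le hw1 hm

/-- If `e = p - b` with `p, b ≥ 0`, the generating function of `e` converges at `1` and the
differences `B w - B (w ^ 2)` of the generating function `B` of `b` are bounded near `1`, then the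
weighted sums of `e` against `y (1 - y) g y` at `y = w ^ n` tend to `0`. -/
theorem tendsto_tsum_sub_mul_weight {p b : ℕ → ℝ} (hp : ∀ n, 0 ≤ p n) (hb : ∀ n, 0 ≤ b n)
    {F B : ℝ → ℝ} {L A : ℝ}
    (hF : ∀ w, 0 ≤ w → w < 1 → HasSum (fun n => p n * w ^ n) (F w))
    (hB : ∀ w, 0 ≤ w → w < 1 → HasSum (fun n => b n * w ^ n) (B w))
    (hL : Tendsto (fun w => F w - B w) (nhdsWithin 1 (Set.Iio 1)) (nhds L))
    (hA : ∀ᶠ w in nhdsWithin 1 (Set.Iio 1), B w - B (w ^ 2) ≤ A)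
    {g : ℝ → ℝ} (hg : ContinuousOn g (Set.Icc 0 1)) :
    Tendsto (fun w => ∑' n, (p n - b n) * (w ^ n * (1 - w ^ n) * g (w ^ n)))
      (nhdsWithin 1 (Set.Iio 1)) (nhds 0) := by
  have hpos : ∀ᶠ w : ℝ in nhdsWithin 1 (Set.Iio 1), 0 < w :=
    eventually_nhdsWithin_of_eventually_nhds (lt_mem_nhds one_pos)
  -- the total variation of the weights stays bounded
  have hvar : ∀ᶠ w in nhdsWithin 1 (Set.Iio 1),
      (F w - B w) - (F (w ^ 2) - B (w ^ 2)) + 2 * (B w - B (w ^ 2)) ≤ 2 * A + 1 := by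
    have h1 := hL.sub (hL.comp (tendsto_pow_nhdsLT_one two_ne_zero))
    rw [sub_self] at h1
    filter_upwards [h1.eventually_lt_const one_pos, hA] with w h1 h2
    simp only [Function.comp] at h1
    linarith
  -- The majorant `∑ (p n + b n) (w ^ n - w ^ (2n))` equals `F w - F (w²) + B w - B (w²)`, here
  -- rewritten through `F - B`.
  have hbound : ∀ w : ℝ, 0 < w → w < 1 → ∀ (f : ℝ → ℝ) (M : ℝ),
      (∀ y ∈ Set.Icc (0 : ℝ) 1, |f y| ≤ M) →
      Summable (fun n => (p n - b n) * (w ^ n * (1 - w ^ n) * f (w ^ n))) ∧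
      |∑' n, (p n - b n) * (w ^ n * (1 - w ^ n) * f (w ^ n))| ≤
        ((F w - B w) - (F (w ^ 2) - B (w ^ 2)) + 2 * (B w - B (w ^ 2))) * M := by
    intro w hw hw1 f M hf
    have hw2 : w ^ 2 < 1 := pow_lt_one₀ hw.le hw1 two_ne_zero
    have hs : HasSum (fun n => (p n + b n) * (w ^ n * (1 - w ^ n)) * M)
        (((F w - B w) - (F (w ^ 2) - B (w ^ 2)) + 2 * (B w - B (w ^ 2))) * M) := by
      refine HasSum.mul_right M ?_
      have h := ((hF w hw.le hw1).sub (hF _ (by positivity) hw2)).add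
        ((hB w hw.le hw1).sub (hB _ (by positivity) hw2))
      have e : ∀ n, (p n + b n) * (w ^ n * (1 - w ^ n)) = p n * w ^ n - p n * (w ^ 2) ^ n +
          (b n * w ^ n - b n * (w ^ 2) ^ n) := by
        intro n
        rw [← pow_mul, mul_comm 2 n, pow_mul]
        ring
      simp only [e]
      rw [show (F w - B w) - (F (w ^ 2) - B (w ^ 2)) + 2 * (B w - B (w ^ 2)) =
        (F w - F (w ^ 2)) + (B w - B (w ^ 2)) by ring]
      exact h
    have hn : ∀ n, ‖(p n - b n) * (w ^ n * (1 - w ^ n) * f (w ^ n))‖ ≤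
        (p n + b n) * (w ^ n * (1 - w ^ n)) * M := by
      intro n
      have h1 : 0 ≤ w ^ n := by positivity
      have h2 : w ^ n ≤ 1 := pow_le_one₀ hw.le hw1.le
      have h3 : |p n - b n| ≤ p n + b n := by
        rw [abs_le]
        constructor <;> linarith [hp n, hb n]
      have h4 : 0 ≤ w ^ n * (1 - w ^ n) := mul_nonneg h1 (by linarith)
      rw [Real.norm_eq_abs, abs_mul, abs_mul, abs_of_nonneg h4, mul_assoc (p n + b n)]
      exact mul_le_mul h3 (mul_le_mul_of_nonneg_left (hf _ ⟨h1, h2⟩) h4)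
        (mul_nonneg h4 (abs_nonneg _)) (by linarith [hp n, hb n])
    exact ⟨Summable.of_norm_bounded hs.summable hn, tsum_of_norm_bounded hs hn⟩
  -- For a monomial `y ^ m` the sum is the difference of `F - B` at `w ^ (m + 1)` and `w ^ (m + 2)`:
  -- the factor `1 - y` cancels `L`, and the factor `y` keeps the exponents positive. Weierstrass
  -- approximation does the rest.
  have hpoly : ∀ R : Polynomial ℝ,
      Tendsto (fun w => ∑' n, (p n - b n) * (w ^ n * (1 - w ^ n) * R.eval (w ^ n)))
        (nhdsWithin 1 (Set.Iio 1)) (nhds 0) := by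
    intro R
    have hE : ∀ m : ℕ, Tendsto (fun w => F (w ^ (m + 1)) - B (w ^ (m + 1)))
        (nhdsWithin 1 (Set.Iio 1)) (nhds L) := fun m =>
      hL.comp (tendsto_pow_nhdsLT_one m.succ_ne_zero)
    have ht : Tendsto (fun w => ∑ m ∈ R.support, R.coeff m *
        ((F (w ^ (m + 1)) - B (w ^ (m + 1))) - (F (w ^ (m + 2)) - B (w ^ (m + 2)))))
        (nhdsWithin 1 (Set.Iio 1)) (nhds 0) := by
      have := tendsto_finsetSum R.support fun m _ =>
        ((hE m).sub (hE (m + 1))).const_mul (R.coeff m)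
      simpa using this
    refine ht.congr' ?_
    filter_upwards [hpos, self_mem_nhdsWithin] with w hw hw1
    have hS : ∀ m : ℕ, HasSum (fun n => (p n - b n) * (w ^ n) ^ (m + 1))
        (F (w ^ (m + 1)) - B (w ^ (m + 1))) := by
      intro m
      have h1 : w ^ (m + 1) < 1 := pow_lt_one₀ hw.le hw1 m.succ_ne_zero
      have h := (hF _ (by positivity) h1).sub (hB _ (by positivity) h1)
      have e : ∀ n, (p n - b n) * (w ^ n) ^ (m + 1) =
          p n * (w ^ (m + 1)) ^ n - b n * (w ^ (m + 1)) ^ n := by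
        intro n
        rw [pow_right_comm]
        ring
      simpa only [e] using h
    have h := hasSum_sum (s := R.support) fun m _ =>
      ((hS m).sub (hS (m + 1))).mul_left (R.coeff m)
    rw [← h.tsum_eq]
    refine tsum_congr fun n => ?_
    rw [Polynomial.eval_eq_sum, Polynomial.sum_def, Finset.mul_sum, Finset.mul_sum]
    refine Finset.sum_congr rfl fun m _ => ?_
    ring
  rw [Metric.tendsto_nhds]
  intro ε hε
  have hA1 : 0 < |2 * A + 1| + 1 := by positivity
  obtain ⟨R, hR⟩ := exists_polynomial_near_of_continuousOn 0 1 g hg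
    (ε / 2 / (|2 * A + 1| + 1)) (by positivity)
  filter_upwards [(Metric.tendsto_nhds.1 (hpoly R)) (ε / 2) (by positivity), hvar, hpos,
    self_mem_nhdsWithin] with w h1 h2 hw hw1
  obtain ⟨s1, b1⟩ := hbound w hw hw1 (fun y => g y - R.eval y) (ε / 2 / (|2 * A + 1| + 1))
    fun y hy => by
      rw [abs_sub_comm]
      exact (hR y hy).le
  obtain ⟨M, hM⟩ := isCompact_Icc.exists_bound_of_continuousOn (s := Set.Icc (0 : ℝ) 1)
    (f := fun y => R.eval y) R.continuous.continuousOn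
  obtain ⟨s2, -⟩ := hbound w hw hw1 (fun y => R.eval y) M hM
  have e : ∑' n, (p n - b n) * (w ^ n * (1 - w ^ n) * g (w ^ n)) =
      ∑' n, (p n - b n) * (w ^ n * (1 - w ^ n) * (g (w ^ n) - R.eval (w ^ n))) +
      ∑' n, (p n - b n) * (w ^ n * (1 - w ^ n) * R.eval (w ^ n)) := by
    rw [← s1.tsum_add s2]
    exact tsum_congr fun n => by ring
  rw [Real.dist_eq, sub_zero] at h1 ⊢
  have hle : ((F w - B w) - (F (w ^ 2) - B (w ^ 2)) + 2 * (B w - B (w ^ 2))) *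
      (ε / 2 / (|2 * A + 1| + 1)) ≤ ε / 2 := by
    calc _ ≤ (|2 * A + 1| + 1) * (ε / 2 / (|2 * A + 1| + 1)) := by
          refine mul_le_mul_of_nonneg_right ?_ (by positivity)
          linarith [le_abs_self (2 * A + 1)]
      _ = ε / 2 := by field_simp
  rw [e]
  refine (abs_add_le _ _).trans_lt ?_
  linarith

/-- A nonnegative weight on `[0, ∞)`, positive exactly on `(α, β)`. -/
noncomputable def expBump (α β x : ℝ) : ℝ :=
  Real.exp (-x) * (1 - Real.exp (-x)) *
    max 0 ((Real.exp (-x) - Real.exp (-β)) * (Real.exp (-α) - Real.exp (-x)))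

theorem continuous_expBump (α β : ℝ) : Continuous (expBump α β) := by
  unfold expBump
  fun_prop

theorem expBump_nonneg (α β : ℝ) {x : ℝ} (hx : 0 ≤ x) : 0 ≤ expBump α β x := by
  have : Real.exp (-x) ≤ 1 := Real.exp_le_one_iff.2 (by linarith)
  exact mul_nonneg (mul_nonneg (Real.exp_nonneg _) (by linarith)) (le_max_left _ _)

theorem expBump_pos {α β x : ℝ} (h0 : 0 < x) (h1 : α < x) (h2 : x < β) : 0 < expBump α β x := by
  have e0 : Real.exp (-x) < 1 := Real.exp_lt_one_iff.2 (by linarith)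
  have e1 : Real.exp (-x) < Real.exp (-α) := Real.exp_lt_exp.2 (by linarith)
  have e2 : Real.exp (-β) < Real.exp (-x) := Real.exp_lt_exp.2 (by linarith)
  exact mul_pos (mul_pos (Real.exp_pos _) (by linarith))
    (lt_max_of_lt_right (mul_pos (by linarith) (by linarith)))

theorem mem_Ioo_of_expBump_ne_zero {α β x : ℝ} (hαβ : α ≤ β) (h : expBump α β x ≠ 0) :
    x ∈ Set.Ioo α β := by
  by_contra hx
  apply h
  rw [expBump, max_eq_left, mul_zero]
  rw [Set.mem_Ioo, not_and_or, not_lt, not_lt] at hx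
  rcases hx with hx | hx
  · exact mul_nonpos_of_nonneg_of_nonpos
      (by linarith [Real.exp_le_exp.2 (show -β ≤ -x by linarith)])
      (by linarith [Real.exp_le_exp.2 (show -α ≤ -x by linarith)])
  · exact mul_nonpos_of_nonpos_of_nonneg
      (by linarith [Real.exp_le_exp.2 (show -x ≤ -β by linarith)])
      (by linarith [Real.exp_le_exp.2 (show -x ≤ -α by linarith)])

theorem summable_mul_expBump {α β : ℝ} (hαβ : α ≤ β) (a : ℕ → ℝ) {n : ℕ} (hn : 0 < n) :
    Summable fun k : ℕ => a k * expBump α β (k / n) := by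
  refine summable_of_ne_finset_zero (s := Finset.range (⌈β * n⌉₊)) fun k hk => ?_
  by_contra h
  have h1 := mem_Ioo_of_expBump_ne_zero hαβ (right_ne_zero_of_mul h)
  rw [Finset.mem_range, not_lt, Nat.ceil_le] at hk
  have hn' : (0 : ℝ) < n := by exact_mod_cast hn
  have := (div_lt_iff₀ hn').1 h1.2
  linarith

/-- On a compact `[α', β'] ⊂ (α, β)` the bump has a positive minimum, and about `(β' - α') n`
indices contribute at least `1 / (β' n)` times it. Half of that count survives rounding once `(β' -
α') n ≥ 2`. -/
theorem exists_pos_le_tsum_inv_mul_expBump {α β : ℝ} (hα : 0 ≤ α) (hαβ : α < β) :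
    ∃ κ > 0, ∀ᶠ n : ℕ in atTop, κ ≤ ∑' k : ℕ, (1 / (k : ℝ)) * expBump α β (k / n) := by
  obtain ⟨α', hα1, hα2⟩ := exists_between hαβ
  obtain ⟨β', hβ1, hβ2⟩ := exists_between hα2
  have hα0 : 0 < α' := by linarith
  have hβ0 : 0 < β' := by linarith
  obtain ⟨x₀, hx₀, hmin⟩ := isCompact_Icc.exists_isMinOn (s := Set.Icc α' β')
    (f := expBump α β) ⟨α', le_rfl, hβ1.le⟩ (continuous_expBump α β).continuousOn
  have hη : 0 < expBump α β x₀ :=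
    expBump_pos (by linarith [hx₀.1]) (by linarith [hx₀.1]) (by linarith [hx₀.2])
  refine ⟨(β' - α') / 2 * (1 / β' * expBump α β x₀), by
    have : 0 < β' - α' := by linarith
    positivity, ?_⟩
  filter_upwards [eventually_gt_atTop 0, eventually_ge_atTop ⌈2 / (β' - α')⌉₊] with n hn hn2
  have hn' : (0 : ℝ) < n := by exact_mod_cast hn
  have hn2' : 2 ≤ (β' - α') * n := by
    have := Nat.ceil_le.1 hn2
    rwa [div_le_iff₀ (by linarith), mul_comm] at this
  refine le_trans ?_ ((summable_mul_expBump hαβ.le _ hn).sum_le_tsum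
    (Finset.Icc ⌈α' * n⌉₊ ⌊β' * n⌋₊) fun k _ =>
      mul_nonneg (by positivity) (expBump_nonneg α β (by positivity)))
  have hterm : ∀ k ∈ Finset.Icc ⌈α' * n⌉₊ ⌊β' * n⌋₊,
      1 / (β' * n) * expBump α β x₀ ≤ 1 / (k : ℝ) * expBump α β (k / n) := by
    intro k hk
    rw [Finset.mem_Icc, Nat.ceil_le, Nat.le_floor_iff (by positivity)] at hk
    have hk0 : (0 : ℝ) < k := lt_of_lt_of_le (by positivity) hk.1
    refine mul_le_mul (one_div_le_one_div_of_le hk0 hk.2) (hmin ⟨?_, ?_⟩) hη.le (by positivity)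
    · rw [le_div_iff₀ hn']
      exact hk.1
    · rw [div_le_iff₀ hn']
      exact hk.2
  refine le_trans ?_ (Finset.card_nsmul_le_sum _ _ _ hterm)
  have hcard : (β' - α') / 2 * n ≤ ((Finset.Icc ⌈α' * n⌉₊ ⌊β' * n⌋₊).card : ℝ) := by
    rw [Nat.card_Icc]
    have h1 := Nat.lt_floor_add_one (β' * n)
    have h2 := Nat.ceil_lt_add_one (show 0 ≤ α' * n by positivity)
    have h3 : ((⌊β' * n⌋₊ + 1 : ℕ) : ℝ) - (⌈α' * n⌉₊ : ℝ) ≤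
        ((⌊β' * n⌋₊ + 1 - ⌈α' * n⌉₊ : ℕ) : ℝ) := by
      rw [sub_le_iff_le_add]
      norm_cast
      omega
    push_cast at h3
    nlinarith
  rw [nsmul_eq_mul]
  calc _ = (β' - α') / 2 * n * (1 / (β' * n) * expBump α β x₀) := by field_simp
    _ ≤ _ := mul_le_mul_of_nonneg_right hcard (by positivity)

/-- The weighted comparison at `w = exp (-1 / n)`, against `b k = c / k`; here `B w - B (w²) = c log
(1 + w)` is bounded. -/
theorem tendsto_tsum_sub_mul_expBump {p : ℕ → ℝ} (hp : ∀ n, 0 ≤ p n) {c L : ℝ} (hc : 0 ≤ c)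
    {F : ℝ → ℝ} (hF : ∀ w, 0 ≤ w → w < 1 → HasSum (fun n => p n * w ^ n) (F w))
    (hL : Tendsto (fun w => F w + c * Real.log (1 - w)) (nhdsWithin 1 (Set.Iio 1)) (nhds L))
    (α β : ℝ) :
    Tendsto (fun n : ℕ => ∑' k : ℕ, (p k - c / k) * expBump α β (k / n)) atTop (nhds 0) := by
  have hlog : ∀ᶠ w : ℝ in nhdsWithin 1 (Set.Iio 1),
      -c * Real.log (1 - w) - -c * Real.log (1 - w ^ 2) ≤ c * Real.log 2 := by
    have hpos : ∀ᶠ w : ℝ in nhdsWithin 1 (Set.Iio 1), 0 < w :=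
      eventually_nhdsWithin_of_eventually_nhds (lt_mem_nhds one_pos)
    filter_upwards [hpos, self_mem_nhdsWithin] with w hw hw1
    have hw1 : w < 1 := hw1
    rw [show 1 - w ^ 2 = (1 - w) * (1 + w) by ring,
      Real.log_mul (by linarith) (by linarith)]
    have := mul_le_mul_of_nonneg_left (Real.log_le_log (by linarith)
      (show 1 + w ≤ 2 by linarith)) hc
    linarith
  have h := tendsto_tsum_sub_mul_weight (b := fun k : ℕ => c / k) hp (fun k => by positivity) hF
    (fun w => hasSum_div_mul_pow c) (by simpa only [neg_mul, sub_neg_eq_add] using hL) hlog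
    (g := fun y => max 0 ((y - Real.exp (-β)) * (Real.exp (-α) - y)))
    (Continuous.continuousOn (by fun_prop))
  have hw : Tendsto (fun n : ℕ => Real.exp (-(1 / (n : ℝ)))) atTop
      (nhdsWithin 1 (Set.Iio 1)) := by
    refine tendsto_nhdsWithin_iff.2 ⟨?_, ?_⟩
    · have := (Real.continuous_exp.tendsto _).comp tendsto_one_div_atTop_nhds_zero_nat.neg
      simpa [Function.comp_def] using this
    · filter_upwards [eventually_gt_atTop 0] with n hn
      have : (0 : ℝ) < n := by exact_mod_cast hn
      exact Real.exp_lt_one_iff.2 (by simpa using this)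
  refine (h.comp hw).congr fun n => tsum_congr fun k => ?_
  rw [← Real.exp_nat_mul, expBump, show (k : ℝ) * -(1 / (n : ℝ)) = -((k : ℝ) / n) by ring]

theorem tendsto_nat_mul_of_antitone {p : ℕ → ℝ} (hanti : Antitone p) (hp : ∀ n, 0 ≤ p n)
    {c L : ℝ} (hc : 0 ≤ c) {F : ℝ → ℝ}
    (hF : ∀ w, 0 ≤ w → w < 1 → HasSum (fun n => p n * w ^ n) (F w))
    (hL : Tendsto (fun w => F w + c * Real.log (1 - w)) (nhdsWithin 1 (Set.Iio 1)) (nhds L)) :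
    Tendsto (fun n : ℕ => n * p n) atTop (nhds c) := by
  have hsplit : ∀ {α β : ℝ}, α ≤ β → ∀ {n : ℕ}, 0 < n →
      ∑' k : ℕ, (p k - c / k) * expBump α β (k / n) =
        ∑' k : ℕ, p k * expBump α β (k / n) -
          c * ∑' k : ℕ, 1 / (k : ℝ) * expBump α β (k / n) := by
    intro α β h n hn
    rw [← tsum_mul_left, ← (summable_mul_expBump h p hn).tsum_sub
      ((summable_mul_expBump h (fun k : ℕ => 1 / (k : ℝ)) hn).mul_left c)]
    exact tsum_congr fun k => by ring
  -- On the window `n < k < (1 + δ) n`, monotonicity gives `p k ≤ p n ≤ (1 + δ) n p n / k`. The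
  -- error allowed is `δ κ`, at most `δ` times the sum of `1 / k` against the bump.
  have lower : ∀ δ > 0, ∀ᶠ n : ℕ in atTop, (c - δ) / (1 + δ) ≤ n * p n := by
    intro δ hδ
    obtain ⟨κ, hκ, hV⟩ := exists_pos_le_tsum_inv_mul_expBump zero_le_one
      (show (1 : ℝ) < 1 + δ by linarith)
    have ht := tendsto_tsum_sub_mul_expBump hp hc hF hL 1 (1 + δ)
    filter_upwards [hV, ht.eventually_const_lt (show -(δ * κ) < 0 by nlinarith),
      eventually_gt_atTop 0] with n hV ht hn
    have hn' : (0 : ℝ) < n := by exact_mod_cast hn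
    rw [hsplit (by linarith) hn] at ht
    have hP : ∑' k : ℕ, p k * expBump 1 (1 + δ) (k / n) ≤
        (1 + δ) * (n * p n) * ∑' k : ℕ, 1 / (k : ℝ) * expBump 1 (1 + δ) (k / n) := by
      rw [← tsum_mul_left]
      refine (summable_mul_expBump (by linarith) p hn).tsum_le_tsum (fun k => ?_)
        ((summable_mul_expBump (by linarith) _ hn).mul_left _)
      by_cases h0 : expBump 1 (1 + δ) (k / n) = 0
      · simp [h0]
      obtain ⟨h1, h2⟩ := mem_Ioo_of_expBump_ne_zero (by linarith) h0
      rw [lt_div_iff₀ hn', one_mul] at h1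
      rw [div_lt_iff₀ hn'] at h2
      have hk0 : (0 : ℝ) < k := hn'.trans h1
      have hkn : p k ≤ p n := hanti (by exact_mod_cast h1.le)
      rw [← mul_assoc]
      refine mul_le_mul_of_nonneg_right ?_ (expBump_nonneg _ _ (by positivity))
      rw [mul_one_div, le_div_iff₀ hk0]
      nlinarith [hp n, hp k]
    rw [div_le_iff₀ (by linarith)]
    by_contra hcon
    push Not at hcon
    nlinarith
  -- The mirror argument on `(1 - δ) n < k < n`, where `p k ≥ p n ≥ (1 - δ) n p n / k`.
  have upper : ∀ δ > 0, δ < 1 → ∀ᶠ n : ℕ in atTop, n * p n ≤ (c + δ) / (1 - δ) := by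
    intro δ hδ hδ1
    obtain ⟨κ, hκ, hV⟩ := exists_pos_le_tsum_inv_mul_expBump (show 0 ≤ 1 - δ by linarith)
      (show 1 - δ < (1 : ℝ) by linarith)
    have ht := tendsto_tsum_sub_mul_expBump hp hc hF hL (1 - δ) 1
    filter_upwards [hV, ht.eventually_lt_const (show 0 < δ * κ by positivity),
      eventually_gt_atTop 0] with n hV ht hn
    have hn' : (0 : ℝ) < n := by exact_mod_cast hn
    rw [hsplit (by linarith) hn] at ht
    have hP : (1 - δ) * (n * p n) * ∑' k : ℕ, 1 / (k : ℝ) * expBump (1 - δ) 1 (k / n) ≤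
        ∑' k : ℕ, p k * expBump (1 - δ) 1 (k / n) := by
      rw [← tsum_mul_left]
      refine ((summable_mul_expBump (by linarith) _ hn).mul_left _).tsum_le_tsum (fun k => ?_)
        (summable_mul_expBump (by linarith) p hn)
      by_cases h0 : expBump (1 - δ) 1 (k / n) = 0
      · simp [h0]
      obtain ⟨h1, h2⟩ := mem_Ioo_of_expBump_ne_zero (by linarith) h0
      rw [lt_div_iff₀ hn'] at h1
      rw [div_lt_iff₀ hn', one_mul] at h2
      have hk0 : (0 : ℝ) < k := lt_of_le_of_lt (mul_nonneg (by linarith) hn'.le) h1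
      have hkn : p n ≤ p k := hanti (by exact_mod_cast h2.le)
      rw [← mul_assoc]
      refine mul_le_mul_of_nonneg_right ?_ (expBump_nonneg _ _ (by positivity))
      rw [mul_one_div, div_le_iff₀ hk0]
      nlinarith [hp n, hp k]
    rw [le_div_iff₀ (by linarith)]
    by_contra hcon
    push Not at hcon
    nlinarith
  refine tendsto_order.2 ⟨fun a ha => ?_, fun a ha => ?_⟩
  · have h1 : Tendsto (fun δ : ℝ => (c - δ) / (1 + δ)) (nhdsWithin 0 (Set.Ioi 0)) (nhds c) := by
      have : ContinuousAt (fun δ : ℝ => (c - δ) / (1 + δ)) 0 := by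
        refine ContinuousAt.div (by fun_prop) (by fun_prop) (by norm_num)
      simpa using this.tendsto.mono_left nhdsWithin_le_nhds
    obtain ⟨δ, h2, h3⟩ := ((h1.eventually_const_lt ha).and self_mem_nhdsWithin).exists
    filter_upwards [lower δ h3] with n hn
    exact h2.trans_le hn
  · have h1 : Tendsto (fun δ : ℝ => (c + δ) / (1 - δ)) (nhdsWithin 0 (Set.Ioi 0)) (nhds c) := by
      have : ContinuousAt (fun δ : ℝ => (c + δ) / (1 - δ)) 0 := by
        refine ContinuousAt.div (by fun_prop) (by fun_prop) (by norm_num)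
      simpa using this.tendsto.mono_left nhdsWithin_le_nhds
    obtain ⟨δ, ⟨h2, h3⟩, h4⟩ := (((h1.eventually_lt_const ha).and self_mem_nhdsWithin).and
      (eventually_nhdsWithin_of_eventually_nhds (gt_mem_nhds one_pos))).exists
    filter_upwards [upper δ h3 h4] with n hn
    exact hn.trans_lt h2

end tauberian

/-! ### Conclusion. -/

theorem IsHPHCWalk.tendsto_nat_mul_measureReal_origin {Ω : Type*} [MeasurableSpace Ω]
    {μ : Measure Ω} [IsProbabilityMeasure μ] {C : ℕ → Ω → ℤ × ℤ} (hC : IsHPHCWalk μ C) :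
    Tendsto (fun N : ℕ => N * μ.real {ω | C (2 * N) ω = (0, 0)}) atTop (nhds (2 / Real.pi)) := by
  obtain ⟨L, hL⟩ := exists_tendsto_integral_inv_hphcDenom_add_log
  exact tendsto_nat_mul_of_antitone
    (IsAnisotropicWalk.antitone_measureReal_origin hC hphcParam_pos hphcParam_le)
    (fun N => measureReal_nonneg) (by positivity) (fun w => hC.hasSum_return_even) hL

theorem theorem3p1 {Ω : Type*} [MeasurableSpace Ω] (μ : Measure Ω) [IsProbabilityMeasure μ]
    (C : ℕ → Ω → ℤ × ℤ) (hC : IsHPHCWalk μ C) :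
    (fun N : ℕ => μ.real {ω | C (2 * N) ω = (0, 0)}) ~[atTop]
      (fun N : ℕ => 2 / (Real.pi * (N : ℝ))) := by
  have hpi := Real.pi_ne_zero
  have hN : ∀ᶠ N : ℕ in atTop, (N : ℝ) ≠ 0 := by
    filter_upwards [eventually_ne_atTop 0] with N hN
    exact_mod_cast hN
  rw [isEquivalent_iff_tendsto_one (by
    filter_upwards [hN] with N hN
    positivity)]
  have h := hC.tendsto_nat_mul_measureReal_origin.div_const (2 / Real.pi)
  rw [div_self (by positivity)] at h
  refine h.congr' ?_
  filter_upwards [hN] with N hN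
  simp only [Pi.div_apply]
  field_simp
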